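/- Let $S$ be an additive sub-semigroup of $[0,\infty)$ such that (S1) $\mathbb{N}=\{0,1,2,\dots\}\subset S$, and (S2) there is a constant $c>0$ with $\sharp(S\cap[n,n+1))\le c^{n+1}$ for every $n\in\mathbb{N}$; fix such a $c$. Let $\mathcal{P}_S$ be the set of probability measures $\mu$ on $\mathbb{R}$ for which there exist complex numbers $(a_\beta)_{\beta\in S,\,\beta>0}$ and $r,R>0$ such that $$\mu|_{\{|x|\ge R\}}(dx)=\sum_{\beta\in S,\,\beta>0}\operatorname{Im}\Bigl(a_\beta\bigl(\tfrac1x\bigr)^{\beta+1}\Bigr)\,dx,\qquad |a_\beta|\le r^\beta,\qquad r<c^{-1}R,$$ where $(1/x)^{\beta+1}$ means $e^{i(\beta+1)\pi}|x|^{-\beta-1}$ for $x<0$. For $\mu\in\mathcal{P}_S$, the $\gamma$-complex moments $(m_\gamma(\mu))_{\gamma\in S}$ are the complex numbers with $m_0(\mu)=1$, with $|m_\gamma(\mu)|\le A^\gamma$ for some $A>0$ and all $\gamma\in S$, $\gamma>0$, and with $$\int_{\mathbb{R}}e^{ixz}\,\mu(dx)=\sum_{\gamma\in S}\frac{m_\gamma(\mu)}{\Gamma(\gamma+1)}\,i^\gamma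 z^\gamma\qquad(z>0),$$ where $i^\gamma=e^{i\pi\gamma/2}$; such a family exists and is unique for every $\mu\in\mathcal{P}_S$. Then: (1) $\mathcal{P}_S$ is closed under the classical convolution $\ast$. (2) For all $\mu,\nu\in\mathcal{P}_S$ and all $\beta\in S$, $$m_\beta(\mu\ast\nu)=\sum_{\gamma,\delta\in S:\ \gamma+\delta=\beta}\frac{\Gamma(\beta+1)}{\Gamma(\gamma+1)\Gamma(\delta+1)}\,m_\gamma(\mu)\,m_\delta(\nu).$$ -/

import Mathlib

open MeasureTheory

namespace PowerLaw

/-- `S` is an additive sub-semigroup of `[0, ∞)` that contains the natural numbers and has at most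
`c ^ (n + 1)` elements in each interval `[n, n + 1)`, where `c > 0` is a constant. -/
structure IsExponentSet (S : AddSubsemigroup ℝ) (c : ℝ) : Prop where
  nonneg : ∀ β ∈ S, 0 ≤ β
  natCast_mem : ∀ n : ℕ, (n : ℝ) ∈ S
  pos : 0 < c
  finite : ∀ n : ℕ, ((S : Set ℝ) ∩ Set.Ico (n : ℝ) (n + 1)).Finite
  card_le : ∀ n : ℕ, (((S : Set ℝ) ∩ Set.Ico (n : ℝ) (n + 1)).ncard : ℝ) ≤ c ^ (n + 1)

/-- Each element of an exponent set is a sum `γ + δ` in only finitely many ways. -/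
theorem IsExponentSet.finite_decompositions {S : AddSubsemigroup ℝ} {c : ℝ}
    (hS : IsExponentSet S c) (β : S) : {p : S × S | p.1 + p.2 = β}.Finite := by
  have hfin : {γ : ℝ | γ ∈ S ∧ γ ≤ β}.Finite := by
    refine (Set.Finite.biUnion (Finset.range (⌊(β : ℝ)⌋₊ + 1)).finite_toSet
      (fun n _ => hS.finite n)).subset ?_
    rintro γ ⟨hγ, hle⟩
    have h0 := hS.nonneg γ hγ
    simp only [Set.mem_iUnion]
    refine ⟨⌊γ⌋₊, ?_, hγ, Nat.floor_le h0, Nat.lt_floor_add_one γ⟩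
    simpa [Nat.lt_succ_iff] using Nat.floor_le_floor hle
  refine Set.Finite.of_finite_image (f := fun p : S × S => (p.1 : ℝ)) (hfin.subset ?_) ?_
  · rintro _ ⟨p, hp, rfl⟩
    have h1 : (p.1 : ℝ) + p.2 = β := congrArg Subtype.val hp
    exact ⟨p.1.2, by have := hS.nonneg _ p.2.2; linarith⟩
  · rintro p hp q hq hpq
    have h1 : (p.1 : ℝ) + p.2 = β := congrArg Subtype.val hp
    have h2 : (q.1 : ℝ) + q.2 = β := congrArg Subtype.val hq
    have h3 : (p.1 : ℝ) = q.1 := hpq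
    exact Prod.ext (Subtype.ext h3) (Subtype.ext (by linarith))

/-- The set `{(γ, δ) ∈ S × S : γ + δ = β}`, as a finite set. -/
noncomputable def IsExponentSet.decompositions {S : AddSubsemigroup ℝ} {c : ℝ}
    (hS : IsExponentSet S c) (β : S) : Finset (S × S) :=
  (hS.finite_decompositions β).toFinset

/-- The power `(1 / x) ^ s` for real `x ≠ 0`, understood to be `e ^ (i s π) |x| ^ (-s)` when
`x < 0`. -/
noncomputable def invPow (x s : ℝ) : ℂ :=
  if 0 < x then ((x ^ (-s) : ℝ) : ℂ)
  else Complex.exp (Complex.I * (s * Real.pi)) * ((|x| ^ (-s) : ℝ) : ℂ)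

/-- The function `∑_{β ∈ S, β > 0} Im (a_β (1 / x) ^ (β + 1))`. -/
noncomputable def tailDensity (S : AddSubsemigroup ℝ) (a : ℝ → ℂ) (x : ℝ) : ℝ :=
  ∑' β : {β : ℝ // β ∈ S ∧ 0 < β}, (a β * invPow x (β + 1)).im

/-- The class of probability measures `μ` on `ℝ` for which there are complex coefficients `a_β` and
`r, R > 0` with `|a_β| ≤ r ^ β`, `r < R / c`, and
`μ|_{|x| ≥ R} (dx) = ∑_{β ∈ S, β > 0} Im (a_β (1 / x) ^ (β + 1)) dx`.

Under the two bounds the series converges absolutely and uniformly on `{|x| ≥ R}`, so its sum is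
continuous there, and the density of a positive measure is nonnegative at every such `x`; the
nonnegativity is spelled out because `ENNReal.ofReal` sends negative numbers to `0`. -/
def powerLawClass (S : AddSubsemigroup ℝ) (c : ℝ) : Set (Measure ℝ) :=
  {μ | IsProbabilityMeasure μ ∧ ∃ (a : ℝ → ℂ) (r R : ℝ), 0 < r ∧ 0 < R ∧
    (∀ β ∈ S, 0 < β → ‖a β‖ ≤ r ^ β) ∧ r < c⁻¹ * R ∧
    (∀ x : ℝ, R ≤ |x| → 0 ≤ tailDensity S a x) ∧
    μ.restrict {x | R ≤ |x|} =
      (volume.restrict {x | R ≤ |x|}).withDensity (fun x => ENNReal.ofReal (tailDensity S a x))}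

/-- `m` is a family of coefficients with `m_0 = 1`, `|m_γ| ≤ A ^ γ` for some `A > 0`, such that the
Fourier transform of `μ` is `∑_{γ ∈ S} m_γ / Γ(γ + 1) i ^ γ z ^ γ` for `z > 0` (with the principal
power `i ^ γ`). -/
def IsComplexMomentFamily (S : AddSubsemigroup ℝ) (μ : Measure ℝ) (m : S → ℂ) : Prop :=
  (∃ A : ℝ, 0 < A ∧ ∀ γ : S, 0 < (γ : ℝ) → ‖m γ‖ ≤ A ^ (γ : ℝ)) ∧
  (∀ γ : S, (γ : ℝ) = 0 → m γ = 1) ∧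
  ∀ z : ℝ, 0 < z →
    HasSum (fun γ : S => m γ / (Real.Gamma (γ + 1) : ℂ) * Complex.I ^ ((γ : ℝ) : ℂ) *
      ((z ^ (γ : ℝ) : ℝ) : ℂ)) (charFun μ z)

open Classical in
/-- The `γ`-complex moment `m_γ(μ)`: the coefficient in the expansion of the Fourier transform
(with value `0` if there is no such expansion). -/
noncomputable def complexMoment (S : AddSubsemigroup ℝ) (μ : Measure ℝ) : S → ℂ :=
  if h : ∃ m : S → ℂ, IsComplexMomentFamily S μ m then h.choose else 0

end PowerLaw

/-! A probability measure lies in the class exactly when its Fourier transform on `z > 0` has an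
expansion with exponents in `S` and geometrically bounded moments. Granted this, convolution
multiplies the transforms, the Cauchy product of two expansions is again such an expansion
(`IsComplexMomentFamily.conv`), and uniqueness of coefficients gives the formula for the moments.

From tail to expansion (`exists_isComplexMomentFamily`): the part of `μ` on `|x| < R` has an entire
transform. Each tail term contributes `K z ^ β` plus an entire function, without a logarithm even
for integral `β`, because the two half-lines carry coefficients linked by the phase `e ^ (iπ(β +
1))`. The entire parts are summed into the integral exponents, which lie in `S`.

From expansion to tail (`IsComplexMomentFamily.mem_powerLawClass`): the Laplace transform turns the
expansion into `∑ m_γ u ^ (γ + 1)` for the Cauchy transform in the coordinate `u = 1 / w`, first on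
the imaginary axis and then, by the identity theorem, on a half-disc. The series extends
continuously to the real boundary away from `0`, so Stieltjes inversion exhibits its imaginary part
divided by `π` as the density of `μ` far out. -/

namespace PowerLaw

open Filter Topology

/-! ### Exponent sets: summability and spacing. -/

namespace IsExponentSet

variable {S : AddSubsemigroup ℝ} {c : ℝ}

theorem one_le (hS : IsExponentSet S c) : 1 ≤ c := by
  have h := hS.card_le 0
  have hne : 0 < ((S : Set ℝ) ∩ Set.Ico ((0 : ℕ) : ℝ) ((0 : ℕ) + 1)).ncard := by
    rw [Set.ncard_pos (hS.finite 0)]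
    exact ⟨0, by simpa using hS.natCast_mem 0, by simp⟩
  have : (1 : ℝ) ≤ (((S : Set ℝ) ∩ Set.Ico ((0 : ℕ) : ℝ) ((0 : ℕ) + 1)).ncard : ℝ) := by
    exact_mod_cast hne
  simpa using this.trans h

/-- Group exponents by integer part: at most `c ^ (n + 1)` of them have floor `n`, each contributing
at most `q ^ n`, so the sum is dominated by the geometric series of ratio `q * c`. -/
theorem summable_rpow (hS : IsExponentSet S c) {q : ℝ} (hq : 0 < q) (hqc : q * c < 1) :
    Summable fun γ : S => q ^ (γ : ℝ) := by
  classical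
  have hc := hS.one_le
  have hq1 : q ≤ 1 := by nlinarith
  have hqc0 : 0 < q * c := mul_pos hq hS.pos
  refine summable_of_sum_le (c := c * (1 - q * c)⁻¹)
    (fun γ => Real.rpow_nonneg hq.le _) fun u => ?_
  set N := u.sup (fun γ => ⌊(γ : ℝ)⌋₊) + 1 with hN
  have hmaps : ∀ γ ∈ u, ⌊(γ : ℝ)⌋₊ ∈ Finset.range N := fun γ hγ => by
    have := Finset.le_sup (f := fun γ : S => ⌊(γ : ℝ)⌋₊) hγ
    simp only [hN, Finset.mem_range]
    omega
  rw [← Finset.sum_fiberwise_of_maps_to hmaps]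
  calc ∑ n ∈ Finset.range N, ∑ γ ∈ u.filter fun γ : S => ⌊(γ : ℝ)⌋₊ = n, q ^ (γ : ℝ)
      ≤ ∑ n ∈ Finset.range N, c * (q * c) ^ n := by
        refine Finset.sum_le_sum fun n _ => ?_
        have hcard : ((u.filter fun γ : S => ⌊(γ : ℝ)⌋₊ = n).card : ℝ) ≤ c ^ (n + 1) := by
          refine le_trans ?_ (hS.card_le n)
          rw [← Finset.card_image_of_injective _ Subtype.val_injective, ← Set.ncard_coe_finset]
          refine Nat.cast_le.2 (Set.ncard_le_ncard ?_ (hS.finite n))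
          intro x hx
          simp only [Finset.coe_image, Finset.coe_filter, Set.mem_image, Set.mem_ofPred_eq] at hx
          obtain ⟨γ, ⟨_, hγ⟩, rfl⟩ := hx
          refine ⟨γ.2, ?_⟩
          rw [Set.mem_Ico, ← hγ]
          exact ⟨Nat.floor_le (hS.nonneg _ γ.2), Nat.lt_floor_add_one _⟩
        calc ∑ γ ∈ u.filter fun γ : S => ⌊(γ : ℝ)⌋₊ = n, q ^ (γ : ℝ)
            ≤ ∑ γ ∈ u.filter fun γ : S => ⌊(γ : ℝ)⌋₊ = n, q ^ n := by
              refine Finset.sum_le_sum fun γ hγ => ?_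
              rw [← Real.rpow_natCast]
              refine Real.rpow_le_rpow_of_exponent_ge hq hq1 ?_
              rw [← (Finset.mem_filter.1 hγ).2]
              exact Nat.floor_le (hS.nonneg _ γ.2)
          _ ≤ c ^ (n + 1) * q ^ n := by
              rw [Finset.sum_const, nsmul_eq_mul]
              exact mul_le_mul_of_nonneg_right hcard (by positivity)
          _ = c * (q * c) ^ n := by ring
    _ = c * ∑ n ∈ Finset.range N, (q * c) ^ n := by rw [Finset.mul_sum]
    _ ≤ c * (1 - q * c)⁻¹ := by
        refine mul_le_mul_of_nonneg_left ?_ hS.pos.le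
        rw [← tsum_geometric_of_lt_one hqc0.le hqc]
        exact (summable_geometric_of_lt_one hqc0.le hqc).sum_le_tsum _
          (fun _ _ => by positivity)

theorem countable (hS : IsExponentSet S c) : Countable S := by
  have hc := hS.pos
  have h := (hS.summable_rpow (q := (2 * c)⁻¹) (by positivity)
    (by rw [mul_inv, mul_assoc, inv_mul_cancel₀ hc.ne']; norm_num)).countable_support
  rw [Function.support_eq_univ] at h
  · exact Set.countable_univ_iff.1 h
  · intro γ
    exact (Real.rpow_pos_of_pos (by positivity) _).ne'

theorem finite_le (hS : IsExponentSet S c) (b : ℝ) : {γ : ℝ | γ ∈ S ∧ γ ≤ b}.Finite := by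
  refine (Set.Finite.biUnion (Finset.range (⌊b⌋₊ + 1)).finite_toSet
    (fun n _ => hS.finite n)).subset ?_
  rintro γ ⟨hγ, hle⟩
  simp only [Set.mem_iUnion]
  refine ⟨⌊γ⌋₊, ?_, hγ, Nat.floor_le (hS.nonneg γ hγ), Nat.lt_floor_add_one γ⟩
  simpa [Nat.lt_succ_iff] using Nat.floor_le_floor hle

theorem exists_pos_le (hS : IsExponentSet S c) :
    ∃ b : ℝ, 0 < b ∧ b ≤ 1 ∧ ∀ γ ∈ S, 0 < γ → b ≤ γ := by
  have hfin : {γ : ℝ | γ ∈ S ∧ 0 < γ ∧ γ ≤ 1}.Finite :=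
    (hS.finite_le 1).subset fun γ h => ⟨h.1, h.2.2⟩
  obtain ⟨b, hb, hmin⟩ := Set.exists_min_image _ id hfin
    ⟨1, by simpa using hS.natCast_mem 1, one_pos, le_rfl⟩
  refine ⟨b, hb.2.1, hb.2.2, fun γ hγ h0 => ?_⟩
  rcases le_total γ 1 with h | h
  · exact hmin γ ⟨hγ, h0, h⟩
  · exact hb.2.2.trans h

/-- Positive exponents are at least some `b > 0`, so a constant factor is absorbed into the base: `M
≤ M' ^ (β / b)`. Hence bounds of the form `M * k ^ β` suffice throughout. -/
theorem exists_mul_rpow_le (hS : IsExponentSet S c) (M : ℝ) {k : ℝ} (hk : 0 < k) :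
    ∃ A : ℝ, 0 < A ∧ ∀ β ∈ S, 0 < β → M * k ^ β ≤ A ^ β := by
  obtain ⟨b, hb, -, hmin⟩ := hS.exists_pos_le
  set M' := max M 1
  have hM' : 1 ≤ M' := le_max_right _ _
  refine ⟨M' ^ b⁻¹ * k, by positivity, fun β hβ h0 => ?_⟩
  rw [Real.mul_rpow (by positivity) hk.le, ← Real.rpow_mul (by positivity)]
  refine mul_le_mul_of_nonneg_right ?_ (by positivity)
  calc M ≤ M' ^ (1 : ℝ) := by simp [M']
    _ ≤ _ := Real.rpow_le_rpow_of_exponent_le hM' (by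
      rw [inv_mul_eq_div, le_div_iff₀ hb, one_mul]; exact hmin β hβ h0)

end IsExponentSet

/-! ### Exponential growth against division by the Gamma function. -/

/-- Integrating the hypothesis against `exp (-(k + 1) z)` turns the left side into a multiple of
`Γ(β + 1)` and the right side into `M`. This plays the role of Cauchy's estimate for the
coefficients of series with real exponents. -/
theorem mul_Gamma_le_of_forall_mul_rpow_le {C M k β : ℝ} (hk : 0 ≤ k) (hβ : 0 ≤ β)
    (h : ∀ z : ℝ, 0 < z → C * z ^ β ≤ M * Real.exp (k * z)) :
    C * Real.Gamma (β + 1) ≤ M * (k + 1) ^ (β + 1) := by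
  have hk1 : 0 < k + 1 := by linarith
  have h1 := Real.integral_rpow_mul_exp_neg_mul_Ioi (a := β + 1) (r := k + 1) (by linarith) hk1
  have hi1 : IntegrableOn (fun t : ℝ => t ^ (β + 1 - 1) * Real.exp (-((k + 1) * t))) (Set.Ioi 0) := by
    -- A non-integrable function has integral `0` by convention, whereas the known value is
    -- positive.
    by_contra hcon
    rw [integral_undef hcon] at h1
    have : 0 < (1 / (k + 1)) ^ (β + 1) * Real.Gamma (β + 1) :=
      mul_pos (Real.rpow_pos_of_pos (by positivity) _) (Real.Gamma_pos_of_pos (by linarith))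
    linarith
  have h2 : ∫ t in Set.Ioi (0 : ℝ), Real.exp (-t) = 1 := by simpa using integral_exp_neg_Ioi 0
  have hi2 : IntegrableOn (fun t : ℝ => Real.exp (-t)) (Set.Ioi 0) := by
    simpa using exp_neg_integrableOn_Ioi 0 one_pos
  have h3 : C * ((1 / (k + 1)) ^ (β + 1) * Real.Gamma (β + 1)) ≤ M * 1 := by
    rw [← h1]
    refine le_of_le_of_eq ?_ (congrArg (M * ·) h2)
    simp only [← integral_const_mul]
    refine setIntegral_mono_on (hi1.const_mul _) (hi2.const_mul _) measurableSet_Ioi fun t ht => ?_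
    have := mul_le_mul_of_nonneg_right (h t ht) (Real.exp_pos (-((k + 1) * t))).le
    rw [add_sub_cancel_right]
    calc _ = C * t ^ β * Real.exp (-((k + 1) * t)) := by ring
      _ ≤ _ := this
      _ = _ := by rw [mul_assoc, ← Real.exp_add]; ring_nf
  rw [Real.div_rpow zero_le_one hk1.le, Real.one_rpow] at h3
  have hp : 0 < (k + 1) ^ (β + 1) := Real.rpow_pos_of_pos hk1 _
  calc C * Real.Gamma (β + 1)
      = (C * (1 / (k + 1) ^ (β + 1) * Real.Gamma (β + 1))) * (k + 1) ^ (β + 1) := by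
        field_simp
    _ ≤ M * 1 * (k + 1) ^ (β + 1) := mul_le_mul_of_nonneg_right h3 hp.le
    _ = _ := by ring

/-- On `(x, x + 1]` the integrand of `Γ(γ + 1)` is at least `exp (-(x + 1)) * x ^ γ`. This crude
bound replaces Stirling's formula. -/
theorem rpow_le_exp_mul_Gamma {x γ : ℝ} (hx : 0 < x) (hγ : 0 ≤ γ) :
    x ^ γ ≤ Real.exp (x + 1) * Real.Gamma (γ + 1) := by
  have hint := Real.GammaIntegral_convergent (s := γ + 1) (by linarith)
  have h1 : Real.exp (-(x + 1)) * x ^ γ ≤ Real.Gamma (γ + 1) := by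
    rw [Real.Gamma_eq_integral (by linarith)]
    calc Real.exp (-(x + 1)) * x ^ γ
        = ∫ t in Set.Ioc x (x + 1), Real.exp (-(x + 1)) * x ^ γ := by simp
      _ ≤ ∫ t in Set.Ioc x (x + 1), Real.exp (-t) * t ^ (γ + 1 - 1) := by
          refine setIntegral_mono_on (integrableOn_const (by simp))
            (hint.mono_set fun t ht => hx.trans ht.1) measurableSet_Ioc fun t ht => ?_
          rw [add_sub_cancel_right]
          have := ht.1
          have := ht.2
          gcongr
      _ ≤ _ := by
          refine setIntegral_mono_set hint ?_ (LE.le.eventuallyLE fun t ht => hx.trans ht.1)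
          filter_upwards [ae_restrict_mem measurableSet_Ioi] with t ht
          have : (0:ℝ) < t := ht
          simp only [Pi.zero_apply]
          positivity
  calc x ^ γ = Real.exp (x + 1) * (Real.exp (-(x + 1)) * x ^ γ) := by
        rw [← mul_assoc, ← Real.exp_add]; simp
    _ ≤ _ := by gcongr

/-- The preceding bound at `x = 2cAz` leaves a factor `(2c) ^ (-γ)`, which is summable over `S`. -/
theorem IsExponentSet.exists_tsum_rpow_div_Gamma_le {S : AddSubsemigroup ℝ} {c : ℝ}
    (hS : IsExponentSet S c) {A : ℝ} (hA : 0 < A) :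
    ∃ M k : ℝ, 0 ≤ M ∧ 0 ≤ k ∧ ∀ z : ℝ, 0 < z →
      Summable (fun γ : S => A ^ (γ : ℝ) / Real.Gamma (γ + 1) * z ^ (γ : ℝ)) ∧
      ∑' γ : S, A ^ (γ : ℝ) / Real.Gamma (γ + 1) * z ^ (γ : ℝ) ≤ M * Real.exp (k * z) := by
  have hc := hS.pos
  have hsum := hS.summable_rpow (q := (2 * c)⁻¹) (by positivity)
    (by rw [mul_inv, mul_assoc, inv_mul_cancel₀ hc.ne']; norm_num)
  refine ⟨(∑' γ : S, (2 * c)⁻¹ ^ (γ : ℝ)) * Real.exp 1, 2 * c * A,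
    mul_nonneg (tsum_nonneg fun γ => by positivity) (by positivity), by positivity, fun z hz => ?_⟩
  have hle : ∀ γ : S, A ^ (γ : ℝ) / Real.Gamma (γ + 1) * z ^ (γ : ℝ) ≤
      (2 * c)⁻¹ ^ (γ : ℝ) * Real.exp (2 * c * A * z + 1) := fun γ => by
    have h0 := hS.nonneg _ γ.2
    have hG : 0 < Real.Gamma ((γ : ℝ) + 1) := Real.Gamma_pos_of_pos (by linarith)
    have h := rpow_le_exp_mul_Gamma (x := 2 * c * A * z) (by positivity) h0
    rw [div_mul_eq_mul_div, div_le_iff₀ hG, ← Real.mul_rpow hA.le hz.le, mul_assoc]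
    calc (A * z) ^ (γ : ℝ) = (2 * c)⁻¹ ^ (γ : ℝ) * (2 * c * A * z) ^ (γ : ℝ) := by
          rw [← Real.mul_rpow (by positivity) (by positivity)]
          congr 1
          field_simp
      _ ≤ _ := by gcongr
  have hnn : ∀ γ : S, 0 ≤ A ^ (γ : ℝ) / Real.Gamma (γ + 1) * z ^ (γ : ℝ) := fun γ => by
    have h0 := hS.nonneg _ γ.2
    have hG : 0 < Real.Gamma ((γ : ℝ) + 1) := Real.Gamma_pos_of_pos (by linarith)
    positivity
  have hs := Summable.of_nonneg_of_le hnn hle (hsum.mul_right _)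
  refine ⟨hs, ?_⟩
  calc _ ≤ ∑' γ : S, (2 * c)⁻¹ ^ (γ : ℝ) * Real.exp (2 * c * A * z + 1) :=
        hs.tsum_le_tsum hle (hsum.mul_right _)
    _ = _ := by rw [tsum_mul_right, add_comm, Real.exp_add]; ring

end PowerLaw

/-! ### Uniqueness of expansions, Cauchy products and convolution. -/

namespace PowerLaw

open Filter Topology

variable {S : AddSubsemigroup ℝ} {c : ℝ}

/-- Dominated convergence with bound `‖b γ‖` for `0 < z < 1`: exponents above `γ₀` vanish in the
limit and those below are absent. -/
theorem tendsto_tsum_mul_rpow_sub {b : S → ℂ} (hb : Summable fun γ => ‖b γ‖) (γ₀ : S)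
    (hlt : ∀ γ : S, (γ : ℝ) < γ₀ → b γ = 0) :
    Tendsto (fun z : ℝ => ∑' γ : S, b γ * ((z ^ ((γ : ℝ) - γ₀) : ℝ) : ℂ)) (𝓝[>] 0)
      (𝓝 (b γ₀)) := by
  classical
  have h : Tendsto (fun z : ℝ => ∑' γ : S, b γ * ((z ^ ((γ : ℝ) - γ₀) : ℝ) : ℂ)) (𝓝[>] 0)
      (𝓝 (∑' γ : S, if γ = γ₀ then b γ₀ else 0)) := by
    refine tendsto_tsum_of_dominated_convergence hb (fun γ => ?_) ?_
    · rcases lt_trichotomy (γ : ℝ) γ₀ with h | h | h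
      · rw [if_neg (fun h' => h.ne (congrArg _ h')), hlt γ h]
        simp
      · have : γ = γ₀ := Subtype.ext h
        subst this
        simp
      · rw [if_neg (fun h' => h.ne' (congrArg _ h'))]
        have h1 : Tendsto (fun z : ℝ => z ^ ((γ : ℝ) - γ₀)) (𝓝[>] 0) (𝓝 0) := by
          have h2 := (Real.continuousAt_rpow_const 0 ((γ : ℝ) - γ₀)
            (Or.inr (by linarith))).tendsto
          rw [Real.zero_rpow (by linarith)] at h2
          exact h2.mono_left nhdsWithin_le_nhds
        have h3 := ((Complex.continuous_ofReal.tendsto 0).comp h1).const_mul (b γ)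
        simpa using h3
    · have h1 : Set.Ioo (0 : ℝ) 1 ∈ 𝓝[>] 0 := Ioo_mem_nhdsGT one_pos
      filter_upwards [h1] with z hz γ
      rcases lt_or_ge (γ : ℝ) γ₀ with h | h
      · simp [hlt γ h]
      · rw [norm_mul, Complex.norm_real, Real.norm_of_nonneg (Real.rpow_nonneg hz.1.le _)]
        exact mul_le_of_le_one_right (norm_nonneg _)
          (Real.rpow_le_one hz.1.le hz.2.le (by linarith))
  simpa using h

/-- Only finitely many exponents lie below any bound, so a nonzero family has a leading exponent
`γ₀`. Dividing by `z ^ γ₀` and letting `z → 0+` isolates its coefficient. -/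
theorem IsExponentSet.eq_zero_of_hasSum (hS : IsExponentSet S c) {b : S → ℂ}
    (h : ∀ z : ℝ, 0 < z → HasSum (fun γ : S => b γ * ((z ^ (γ : ℝ) : ℝ) : ℂ)) 0) : b = 0 := by
  by_contra hne
  obtain ⟨γ₁, hγ₁⟩ : ∃ γ, b γ ≠ 0 := by
    by_contra! hcon
    exact hne (funext hcon)
  have hfin : {γ : S | b γ ≠ 0 ∧ (γ : ℝ) ≤ γ₁}.Finite :=
    Set.Finite.of_finite_image (f := ((↑) : S → ℝ))
      ((hS.finite_le γ₁).subset (by rintro _ ⟨γ, hγ, rfl⟩; exact ⟨γ.2, hγ.2⟩))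
      Subtype.val_injective.injOn
  obtain ⟨γ₀, hγ₀, hmin⟩ := Set.exists_min_image _ ((↑) : S → ℝ) hfin ⟨γ₁, hγ₁, le_rfl⟩
  have hlt : ∀ γ : S, (γ : ℝ) < γ₀ → b γ = 0 := fun γ hγ => by
    by_contra hb
    exact absurd (hmin γ ⟨hb, hγ.le.trans hγ₀.2⟩) (not_le.2 hγ)
  have hb : Summable fun γ => ‖b γ‖ := by simpa using (h 1 one_pos).summable.norm
  have h0 := tendsto_tsum_mul_rpow_sub hb γ₀ hlt
  refine hγ₀.1 (tendsto_nhds_unique h0 (tendsto_const_nhds.congr' ?_))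
  filter_upwards [self_mem_nhdsWithin] with z hz
  have hz : 0 < z := hz
  have h1 := (h z hz).mul_right (((z ^ (-(γ₀ : ℝ)) : ℝ) : ℂ))
  rw [zero_mul] at h1
  rw [← h1.tsum_eq]
  refine tsum_congr fun γ => ?_
  rw [sub_eq_add_neg, Real.rpow_add hz]
  push_cast
  ring

theorem IsExponentSet.hasSum_mul_decompositions (hS : IsExponentSet S c) {f g : S → ℂ} {x y : ℂ}
    (hf : HasSum f x) (hg : HasSum g y) :
    HasSum (fun β => ∑ p ∈ hS.decompositions β, f p.1 * g p.2) (x * y) := by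
  have h3 := hf.mul hg (summable_mul_of_summable_norm hf.summable.norm hg.summable.norm)
  refine (h3.tsum_fiberwise (fun p : S × S => p.1 + p.2)).congr_fun fun β => ?_
  have : (fun p : S × S => p.1 + p.2) ⁻¹' {β} = (hS.decompositions β : Set (S × S)) := by
    ext p
    simp [IsExponentSet.decompositions]
  rw [this]
  exact (Finset.tsum_subtype' _ (fun p : S × S => f p.1 * g p.2)).symm

theorem I_cpow_ne_zero (s : ℂ) : Complex.I ^ s ≠ 0 := by
  simp [Complex.cpow_eq_zero_iff]

theorem norm_I_cpow (s : ℝ) : ‖Complex.I ^ (s : ℂ)‖ = 1 := by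
  rw [Complex.norm_cpow_real]
  simp

namespace IsComplexMomentFamily

variable {μ ν : Measure ℝ} {m m' : S → ℂ}

theorem eq (hS : IsExponentSet S c) (h : IsComplexMomentFamily S μ m)
    (h' : IsComplexMomentFamily S μ m') : m = m' := by
  have h0 : (fun γ : S => (m γ - m' γ) / (Real.Gamma (γ + 1) : ℂ) * Complex.I ^ ((γ : ℝ) : ℂ))
      = 0 := by
    refine hS.eq_zero_of_hasSum fun z hz => ?_
    have h1 := (h.2.2 z hz).sub (h'.2.2 z hz)
    rw [sub_self] at h1
    refine h1.congr_fun fun γ => ?_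
    ring
  funext γ
  have h1 := congrFun h0 γ
  have hG : (Real.Gamma ((γ : ℝ) + 1) : ℂ) ≠ 0 := by
    exact_mod_cast (Real.Gamma_pos_of_pos (by linarith [hS.nonneg _ γ.2])).ne'
  simpa [hG, I_cpow_ne_zero, sub_eq_zero, -Complex.ofReal_eq_zero] using h1

theorem exists_norm_le (h : IsComplexMomentFamily S μ m) (hS : IsExponentSet S c) :
    ∃ A : ℝ, 0 < A ∧ ∀ γ : S, ‖m γ‖ ≤ A ^ (γ : ℝ) := by
  obtain ⟨⟨A, hA, hb⟩, h0, -⟩ := h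
  refine ⟨A, hA, fun γ => ?_⟩
  rcases (hS.nonneg _ γ.2).eq_or_lt with h1 | h1
  · rw [h0 γ h1.symm, ← h1]
    simp
  · exact hb γ h1

/-- The normalisation `m_0 = 1` need not be assumed: as `z → 0+` the series tends to its
exponent-zero coefficient and `charFun μ z` to `1`. -/
theorem of_hasSum [IsProbabilityMeasure μ] (hS : IsExponentSet S c) {M k : ℝ} (hk : 0 < k)
    (hm : ∀ γ : S, ‖m γ‖ ≤ M * k ^ (γ : ℝ))
    (h : ∀ z : ℝ, 0 < z →
      HasSum (fun γ : S => m γ / (Real.Gamma (γ + 1) : ℂ) * Complex.I ^ ((γ : ℝ) : ℂ) *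
        ((z ^ (γ : ℝ) : ℝ) : ℂ)) (charFun μ z)) :
    IsComplexMomentFamily S μ m := by
  refine ⟨?_, fun γ₀ hγ₀ => ?_, h⟩
  · obtain ⟨A, hA, hle⟩ := hS.exists_mul_rpow_le M hk
    exact ⟨A, hA, fun γ hγ => (hm γ).trans (hle γ γ.2 hγ)⟩
  · have hb : Summable fun γ : S =>
        ‖m γ / (Real.Gamma (γ + 1) : ℂ) * Complex.I ^ ((γ : ℝ) : ℂ)‖ := by
      simpa using (h 1 one_pos).summable.norm
    have h1 := tendsto_tsum_mul_rpow_sub hb γ₀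
      (fun γ hγ => absurd (hS.nonneg _ γ.2) (not_le.2 (hγ₀ ▸ hγ)))
    have h2 : Tendsto (charFun μ) (𝓝[>] 0) (𝓝 1) := by
      have h3 := (continuous_charFun (μ := μ)).tendsto 0
      rw [charFun_zero] at h3
      simpa using h3.mono_left nhdsWithin_le_nhds
    have h3 := tendsto_nhds_unique h1 (h2.congr' ?_)
    · simpa [hγ₀] using h3
    · filter_upwards [self_mem_nhdsWithin] with z hz
      simp only [hγ₀, sub_zero]
      exact (h z hz).tsum_eq.symm

theorem conv [IsProbabilityMeasure μ] [IsProbabilityMeasure ν] (hS : IsExponentSet S c)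
    (h : IsComplexMomentFamily S μ m) (h' : IsComplexMomentFamily S ν m') :
    IsComplexMomentFamily S (Measure.conv μ ν) fun β => ∑ p ∈ hS.decompositions β,
      ((Real.Gamma (β + 1) / (Real.Gamma (p.1 + 1) * Real.Gamma (p.2 + 1)) : ℝ) : ℂ) *
        m p.1 * m' p.2 := by
  obtain ⟨A, hA, hm⟩ := h.exists_norm_le hS
  obtain ⟨A', hA', hm'⟩ := h'.exists_norm_le hS
  obtain ⟨M, k, hM, hk, hsum⟩ := hS.exists_tsum_rpow_div_Gamma_le hA
  obtain ⟨M', k', hM', hk', hsum'⟩ := hS.exists_tsum_rpow_div_Gamma_le hA'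
  have hG : ∀ γ : S, 0 < Real.Gamma ((γ : ℝ) + 1) := fun γ =>
    Real.Gamma_pos_of_pos (by linarith [hS.nonneg _ γ.2])
  have hGC : ∀ γ : S, (Real.Gamma ((γ : ℝ) + 1) : ℂ) ≠ 0 := fun γ => by
    exact_mod_cast (hG γ).ne'
  have hadd : ∀ β : S, ∀ p ∈ hS.decompositions β, (p.1 : ℝ) + p.2 = β := fun β p hp =>
    congrArg Subtype.val ((hS.finite_decompositions β).mem_toFinset.1 hp)
  refine of_hasSum hS (M := M * M' * (k + k' + 1)) (k := k + k' + 1) (by positivity)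
    (fun β => ?_) fun z hz => ?_
  -- `C` is the coefficient of `z ^ β` in the product of the two majorant series. Their terms are
  -- nonnegative, so `C * z ^ β` is at most the whole product, which has exponential growth of rate
  -- `k + k'`.
  · set C := ∑ p ∈ hS.decompositions β, A ^ (p.1 : ℝ) / Real.Gamma (p.1 + 1) *
      (A' ^ (p.2 : ℝ) / Real.Gamma (p.2 + 1)) with hC
    have h1 : C * Real.Gamma (β + 1) ≤ M * M' * (k + k' + 1) ^ ((β : ℝ) + 1) := by
      refine mul_Gamma_le_of_forall_mul_rpow_le (by positivity) (hS.nonneg _ β.2) fun z hz => ?_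
      obtain ⟨hs, hle⟩ := hsum z hz
      obtain ⟨hs', hle'⟩ := hsum' z hz
      have hnn : ∀ γ : S, 0 ≤ A ^ (γ : ℝ) / Real.Gamma (γ + 1) * z ^ (γ : ℝ) := fun γ => by
        have := hG γ
        positivity
      have hnn' : ∀ γ : S, 0 ≤ A' ^ (γ : ℝ) / Real.Gamma (γ + 1) * z ^ (γ : ℝ) := fun γ => by
        have := hG γ
        positivity
      have hp := hs.mul_of_nonneg hs' hnn hnn'
      calc C * z ^ (β : ℝ) = ∑ p ∈ hS.decompositions β,
            (A ^ (p.1 : ℝ) / Real.Gamma (p.1 + 1) * z ^ (p.1 : ℝ)) *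
              (A' ^ (p.2 : ℝ) / Real.Gamma (p.2 + 1) * z ^ (p.2 : ℝ)) := by
            rw [hC, Finset.sum_mul]
            refine Finset.sum_congr rfl fun p hp => ?_
            rw [← hadd β p hp, Real.rpow_add hz]
            ring
        _ ≤ ∑' p : S × S, (A ^ (p.1 : ℝ) / Real.Gamma (p.1 + 1) * z ^ (p.1 : ℝ)) *
              (A' ^ (p.2 : ℝ) / Real.Gamma (p.2 + 1) * z ^ (p.2 : ℝ)) :=
            hp.sum_le_tsum _ fun p _ => mul_nonneg (hnn _) (hnn' _)
        _ = _ := (hs.tsum_mul_tsum hs' hp).symm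
        _ ≤ M * Real.exp (k * z) * (M' * Real.exp (k' * z)) :=
            mul_le_mul hle hle' (tsum_nonneg hnn') (by positivity)
        _ = _ := by rw [add_mul, Real.exp_add]; ring
    calc _ ≤ C * Real.Gamma (β + 1) := by
          rw [hC, Finset.sum_mul]
          refine (norm_sum_le _ _).trans (Finset.sum_le_sum fun p _ => ?_)
          rw [norm_mul, norm_mul, Complex.norm_real, Real.norm_of_nonneg
            (div_nonneg (hG β).le (mul_pos (hG p.1) (hG p.2)).le)]
          have := hG p.1
          have := hG p.2
          have := hG β
          calc _ ≤ Real.Gamma (β + 1) / (Real.Gamma (p.1 + 1) * Real.Gamma (p.2 + 1)) *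
                A ^ (p.1 : ℝ) * A' ^ (p.2 : ℝ) := by
                gcongr
                · exact hm _
                · exact hm' _
            _ = _ := by field_simp
      _ ≤ _ := h1
      _ = _ := by rw [Real.rpow_add (by positivity), Real.rpow_one]; ring
  · have h1 := h.2.2 z hz
    have h2 := h'.2.2 z hz
    rw [charFun_conv]
    refine (hS.hasSum_mul_decompositions h1 h2).congr_fun fun β => ?_
    rw [Finset.sum_div, Finset.sum_mul, Finset.sum_mul]
    refine Finset.sum_congr rfl fun p hp => ?_
    have e : Complex.I ^ ((β : ℝ) : ℂ) =
        Complex.I ^ ((p.1 : ℝ) : ℂ) * Complex.I ^ ((p.2 : ℝ) : ℂ) := by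
      rw [← Complex.cpow_add _ _ Complex.I_ne_zero, ← hadd β p hp]
      push_cast
      rfl
    have e' : (z ^ (β : ℝ) : ℝ) = z ^ (p.1 : ℝ) * z ^ (p.2 : ℝ) := by
      rw [← Real.rpow_add hz, hadd β p hp]
    rw [e, e']
    have := hGC β
    have := hGC p.1
    have := hGC p.2
    push_cast
    field_simp

end IsComplexMomentFamily

end PowerLaw

/-! ### The Cauchy transform as a generating function of the complex moments. -/

namespace PowerLaw

open Filter Topology

variable {S : AddSubsemigroup ℝ} {c : ℝ} {μ : Measure ℝ} {m : S → ℂ}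

/-- The Cauchy transform `∫ (w - t)⁻¹ μ(dt)`, in the coordinate `u = w⁻¹`. -/
noncomputable def invCauchyTransform (μ : Measure ℝ) (u : ℂ) : ℂ :=
  ∫ t : ℝ, u / (1 - u * t) ∂μ

/-- Multiplying `1 - u t` by the conjugate of `u` gives `conj u - |u|² t`, whose imaginary part does
not involve the real number `t`. This bounds the kernel uniformly in `t`. -/
theorem im_le_norm_mul_norm_one_sub (u : ℂ) (t : ℝ) : |u.im| ≤ ‖u‖ * ‖1 - u * t‖ := by
  calc |u.im| = |((starRingEnd ℂ) u * (1 - u * t)).im| := by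
        have : (starRingEnd ℂ) u * (1 - u * t) = (starRingEnd ℂ) u - ((Complex.normSq u * t : ℝ) : ℂ) := by
          push_cast
          rw [Complex.normSq_eq_conj_mul_self]
          ring
        rw [this, Complex.sub_im, Complex.ofReal_im, Complex.conj_im]
        simp
    _ ≤ ‖(starRingEnd ℂ) u * (1 - u * t)‖ := Complex.abs_im_le_norm _
    _ = _ := by rw [norm_mul, RCLike.norm_conj]

theorem one_sub_mul_ne_zero {u : ℂ} (hu : 0 < u.im) (t : ℝ) : 1 - u * t ≠ 0 := fun h => by
  have := im_le_norm_mul_norm_one_sub u t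
  rw [h, norm_zero, mul_zero, abs_of_pos hu] at this
  linarith

theorem norm_div_one_sub_mul_le {u : ℂ} (hu : 0 < u.im) (t : ℝ) :
    ‖u / (1 - u * t)‖ ≤ ‖u‖ ^ 2 / u.im := by
  have h := im_le_norm_mul_norm_one_sub u t
  rw [abs_of_pos hu] at h
  have h1 : 0 < ‖1 - u * t‖ := norm_pos_iff.2 (one_sub_mul_ne_zero hu t)
  rw [norm_div, div_le_div_iff₀ h1 hu]
  nlinarith [mul_le_mul_of_nonneg_left h (norm_nonneg u)]

theorem measurable_div_one_sub_mul (u : ℂ) : Measurable fun t : ℝ => u / (1 - u * t) :=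
  measurable_const.div (measurable_const.sub (measurable_const.mul Complex.measurable_ofReal))

theorem integrable_div_one_sub_mul [IsFiniteMeasure μ] {u : ℂ} (hu : 0 < u.im) :
    Integrable (fun t : ℝ => u / (1 - u * t)) μ :=
  (integrable_const (‖u‖ ^ 2 / u.im)).mono' (measurable_div_one_sub_mul u).aestronglyMeasurable
    (ae_of_all _ (norm_div_one_sub_mul_le hu))

theorem differentiableOn_invCauchyTransform [IsFiniteMeasure μ] :
    DifferentiableOn ℂ (invCauchyTransform μ) {u | 0 < u.im} := by
  intro u₀ hu₀
  have hu₀ : 0 < u₀.im := hu₀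
  refine DifferentiableAt.differentiableWithinAt ?_
  -- On this ball the imaginary part stays above `u₀.im / 2`, so `‖1 - u t‖⁻¹` is bounded by a
  -- constant `B` independent of `t`.
  have him : ∀ u ∈ Metric.ball u₀ (u₀.im / 2), u₀.im / 2 < u.im := fun u hu => by
    have h1 := (Complex.abs_im_le_norm (u - u₀)).trans_lt (mem_ball_iff_norm.1 hu)
    rw [Complex.sub_im, abs_lt] at h1
    linarith
  have hnorm : ∀ u ∈ Metric.ball u₀ (u₀.im / 2), ‖u‖ ≤ ‖u₀‖ + u₀.im / 2 := fun u hu => by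
    have h1 := mem_ball_iff_norm.1 hu
    calc ‖u‖ = ‖u₀ + (u - u₀)‖ := by congr 1; ring
      _ ≤ _ := (norm_add_le _ _).trans (by linarith)
  have hball : Metric.ball u₀ (u₀.im / 2) ∈ 𝓝 u₀ := Metric.ball_mem_nhds _ (by linarith)
  set B := (‖u₀‖ + u₀.im / 2) / (u₀.im / 2)
  refine (hasDerivAt_integral_of_dominated_loc_of_deriv_le (μ := μ) (F := fun (u : ℂ) (t : ℝ) =>
    u / (1 - u * t)) (F' := fun (u : ℂ) (t : ℝ) => (1 - u * t)⁻¹ ^ 2) (bound := fun _ => B ^ 2) hball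
    (Eventually.of_forall fun u => (measurable_div_one_sub_mul u).aestronglyMeasurable)
    (integrable_div_one_sub_mul hu₀) ?_ ?_ (integrable_const _) ?_).2.differentiableAt
  · exact ((measurable_const.sub
      (measurable_const.mul Complex.measurable_ofReal)).inv.pow_const 2).aestronglyMeasurable
  · refine ae_of_all _ fun t u hu => ?_
    have h1 := him u hu
    have h2 := im_le_norm_mul_norm_one_sub u t
    rw [abs_of_pos (by linarith)] at h2
    rw [norm_pow, norm_inv]
    have h3 : 0 < ‖1 - u * t‖ := norm_pos_iff.2 (one_sub_mul_ne_zero (by linarith) t)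
    refine pow_le_pow_left₀ (by positivity) ?_ 2
    rw [inv_le_comm₀ h3 (by positivity), inv_div, div_le_iff₀ (by positivity)]
    calc u₀.im / 2 ≤ ‖u‖ * ‖1 - u * t‖ := h1.le.trans h2
      _ ≤ _ := by rw [mul_comm]; gcongr; exact hnorm u hu
  · refine ae_of_all _ fun t u hu => ?_
    have h1 := one_sub_mul_ne_zero (u := u) (by linarith [him u hu]) t
    have h2 : HasDerivAt (fun u : ℂ => 1 - u * t) (-t) u := by
      simpa using ((hasDerivAt_id u).mul_const (t : ℂ)).const_sub 1
    convert! (hasDerivAt_id u).div h2 h1 using 1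
    field_simp
    simp only [id_eq]
    ring

theorem norm_mul_cpow_le {A ρ : ℝ} (hS : IsExponentSet S c) (hm : ∀ γ : S, ‖m γ‖ ≤ A ^ (γ : ℝ))
    (hA : 0 < A) (hρ : 0 < ρ) {u : ℂ} (hu : ‖u‖ ≤ ρ⁻¹) (γ : S) :
    ‖m γ * u ^ (((γ : ℝ) + 1 : ℝ) : ℂ)‖ ≤ (A / ρ) ^ (γ : ℝ) * ρ⁻¹ := by
  have h0 := hS.nonneg _ γ.2
  rw [norm_mul, Complex.norm_cpow_real]
  calc _ ≤ A ^ (γ : ℝ) * ρ⁻¹ ^ ((γ : ℝ) + 1) := by gcongr; exact hm γ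
    _ = _ := by
      rw [Real.rpow_add (by positivity), Real.rpow_one, div_eq_mul_inv,
        Real.mul_rpow hA.le (by positivity)]
      ring

theorem IsExponentSet.summable_div_rpow (hS : IsExponentSet S c) {A ρ : ℝ} (hA : 0 < A)
    (hρ : c * A < ρ) : Summable fun γ : S => (A / ρ) ^ (γ : ℝ) * ρ⁻¹ := by
  have hρ0 : 0 < ρ := (mul_pos hS.pos hA).trans hρ
  refine (hS.summable_rpow (by positivity) ?_).mul_right _
  rw [div_mul_eq_mul_div, div_lt_one hρ0]
  linarith

/-- By Fubini the inner integral is `1 / (p - it)`, and `i / (p - it) = u / (1 - u t)` for `u = i /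
p`. -/
theorem integral_exp_neg_mul_charFun [IsFiniteMeasure μ] {p : ℝ} (hp : 0 < p) :
    Complex.I * ∫ z in Set.Ioi (0 : ℝ), Complex.exp (-(p * z)) * charFun μ z =
      invCauchyTransform μ (Complex.I * (p⁻¹ : ℝ)) := by
  have hexp : ∀ (z t : ℝ), Complex.exp (-(p * z)) * Complex.exp (z * t * Complex.I) =
      Complex.exp ((-p + t * Complex.I) * z) := fun z t => by
    rw [← Complex.exp_add]
    congr 1
    ring
  have hint : Integrable (Function.uncurry fun (z : ℝ) (t : ℝ) =>
      Complex.exp ((-p + t * Complex.I) * z)) ((volume.restrict (Set.Ioi 0)).prod μ) := by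
    have h1 : Integrable (fun z : ℝ => Real.exp (-p * z)) (volume.restrict (Set.Ioi 0)) :=
      integrableOn_exp_mul_Ioi (by linarith) 0
    refine (h1.mul_prod (integrable_const (1 : ℝ) (μ := μ))).mono'
      (Continuous.aestronglyMeasurable (by unfold Function.uncurry; fun_prop))
      (ae_of_all _ fun q => ?_)
    simp [Function.uncurry, Complex.norm_exp]
  have hre : ∀ t : ℝ, (-p + t * Complex.I : ℂ).re < 0 := fun t => by simpa using hp
  calc Complex.I * ∫ z in Set.Ioi (0 : ℝ), Complex.exp (-(p * z)) * charFun μ z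
      = Complex.I * ∫ z in Set.Ioi (0 : ℝ), ∫ t : ℝ, Complex.exp ((-p + t * Complex.I) * z) ∂μ := by
        congr 2
        ext z
        rw [charFun_apply_real, ← integral_const_mul]
        simp only [hexp]
    _ = Complex.I * ∫ t : ℝ, (∫ z in Set.Ioi (0 : ℝ), Complex.exp ((-p + t * Complex.I) * z)) ∂μ := by
        rw [integral_integral_swap hint]
    _ = _ := by
        rw [← integral_const_mul, invCauchyTransform]
        congr 1
        ext t
        rw [integral_exp_mul_complex_Ioi (hre t) 0]
        have hne : (-p + t * Complex.I : ℂ) ≠ 0 := fun h => by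
          have := hre t
          rw [h] at this
          simp at this
        have hp' : (p : ℂ) ≠ 0 := by exact_mod_cast hp.ne'
        have hne' : (p - Complex.I * t : ℂ) ≠ 0 := fun h => hne (by linear_combination -h)
        have e : (1 - Complex.I * (p⁻¹ : ℝ) * t : ℂ) = (p - Complex.I * t) / p := by
          push_cast
          field_simp
        rw [e]
        push_cast
        rw [mul_zero, Complex.exp_zero]
        have hne2 : (-p + t * Complex.I : ℂ) = -(p - Complex.I * t) := by ring
        rw [hne2]
        field_simp

/-- Termwise Laplace transform: `z ^ γ` becomes `Γ(γ + 1) p ^ (-γ - 1)`, the Gamma factors cancel,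
and `i · i ^ γ p ^ (-γ - 1) = (i / p) ^ (γ + 1)`. The interchange rests on the summability of `(A /
p) ^ γ` for `p > cA`. -/
theorem hasSum_integral_exp_neg_mul {f : ℝ → ℂ} (hS : IsExponentSet S c) {A p : ℝ} (hA : 0 < A)
    (hm : ∀ γ : S, ‖m γ‖ ≤ A ^ (γ : ℝ)) (hp : c * A < p)
    (h : ∀ z : ℝ, 0 < z →
      HasSum (fun γ : S => m γ / (Real.Gamma (γ + 1) : ℂ) * Complex.I ^ ((γ : ℝ) : ℂ) *
        ((z ^ (γ : ℝ) : ℝ) : ℂ)) (f z)) :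
    HasSum (fun γ : S => m γ * (Complex.I * (p⁻¹ : ℝ)) ^ (((γ : ℝ) + 1 : ℝ) : ℂ))
      (Complex.I * ∫ z in Set.Ioi (0 : ℝ), Complex.exp (-(p * z)) * f z) := by
  have := hS.countable
  have hp0 : 0 < p := (mul_pos hS.pos hA).trans hp
  have hG : ∀ γ : S, 0 < Real.Gamma ((γ : ℝ) + 1) := fun γ =>
    Real.Gamma_pos_of_pos (by linarith [hS.nonneg _ γ.2])
  set F : S → ℝ → ℂ := fun γ z => m γ / (Real.Gamma (γ + 1) : ℂ) * Complex.I ^ ((γ : ℝ) : ℂ) *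
    ((z ^ ((γ : ℝ) + 1 - 1) * Real.exp (-(p * z)) : ℝ) : ℂ) with hF
  have hval : ∀ γ : S, ∫ z in Set.Ioi (0 : ℝ), z ^ ((γ : ℝ) + 1 - 1) * Real.exp (-(p * z)) =
      (1 / p) ^ ((γ : ℝ) + 1) * Real.Gamma ((γ : ℝ) + 1) := fun γ =>
    Real.integral_rpow_mul_exp_neg_mul_Ioi (by linarith [hS.nonneg _ γ.2]) hp0
  have hint : ∀ γ : S, IntegrableOn (fun z : ℝ => z ^ ((γ : ℝ) + 1 - 1) * Real.exp (-(p * z)))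
      (Set.Ioi 0) := fun γ => by
    by_contra hcon
    have h1 := hval γ
    rw [integral_undef hcon] at h1
    exact (mul_pos (Real.rpow_pos_of_pos (by positivity) _) (hG γ)).ne h1
  have hnorm : ∀ γ : S, ∫ z in Set.Ioi (0 : ℝ), ‖F γ z‖ ≤ (A / p) ^ (γ : ℝ) * p⁻¹ := fun γ => by
    have h1 : ∫ z in Set.Ioi (0 : ℝ), ‖F γ z‖ = ‖m γ‖ * (1 / p) ^ ((γ : ℝ) + 1) := by
      calc _ = ∫ z in Set.Ioi (0 : ℝ), ‖m γ‖ / Real.Gamma (γ + 1) *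
            (z ^ ((γ : ℝ) + 1 - 1) * Real.exp (-(p * z))) := by
            refine setIntegral_congr_fun measurableSet_Ioi fun z hz => ?_
            have hz : 0 < z := hz
            simp only [hF]
            rw [norm_mul, norm_mul, norm_I_cpow, norm_div, Complex.norm_real, Complex.norm_real,
              Real.norm_of_nonneg (hG γ).le, Real.norm_of_nonneg (by positivity), mul_one]
        _ = _ := by
            rw [integral_const_mul, hval]
            have := (hG γ).ne'
            field_simp
    rw [h1]
    calc _ ≤ A ^ (γ : ℝ) * (1 / p) ^ ((γ : ℝ) + 1) := by gcongr; exact hm γ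
      _ = _ := by
        rw [Real.rpow_add (by positivity), Real.rpow_one, div_eq_mul_one_div A p,
          Real.mul_rpow hA.le (by positivity), one_div]
        ring
  have hsum := hasSum_integral_of_summable_integral_norm (μ := volume.restrict (Set.Ioi 0))
    (F := F) (fun γ => Integrable.const_mul (hint γ).ofReal _)
    (Summable.of_nonneg_of_le (fun γ => integral_nonneg fun _ => norm_nonneg _) hnorm
      (hS.summable_div_rpow hA hp))
  have h1 : ∫ z in Set.Ioi (0 : ℝ), ∑' γ, F γ z =
      ∫ z in Set.Ioi (0 : ℝ), Complex.exp (-(p * z)) * f z := by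
    refine setIntegral_congr_fun measurableSet_Ioi fun z hz => ?_
    rw [← ((h z hz).mul_left (Complex.exp (-(p * z)))).tsum_eq]
    refine tsum_congr fun γ => ?_
    simp only [hF, add_sub_cancel_right]
    push_cast
    ring
  rw [h1] at hsum
  refine (hsum.mul_left Complex.I).congr_fun fun γ => ?_
  have h2 : ∫ z in Set.Ioi (0 : ℝ), F γ z = m γ / (Real.Gamma (γ + 1) : ℂ) *
      Complex.I ^ ((γ : ℝ) : ℂ) * (((1 / p) ^ ((γ : ℝ) + 1) * Real.Gamma ((γ : ℝ) + 1) : ℝ) : ℂ) := by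
    rw [← hval, ← integral_complex_ofReal, ← integral_const_mul]
  have hGC : (Real.Gamma ((γ : ℝ) + 1) : ℂ) ≠ 0 := by exact_mod_cast (hG γ).ne'
  have h3 : (Complex.I * (p⁻¹ : ℝ)) ^ (((γ : ℝ) + 1 : ℝ) : ℂ) =
      Complex.I * Complex.I ^ ((γ : ℝ) : ℂ) * (((1 / p) ^ ((γ : ℝ) + 1) : ℝ) : ℂ) := by
    have hp1 : 0 < p⁻¹ := by positivity
    rw [mul_comm, Complex.cpow_def_of_ne_zero
      (mul_ne_zero (by exact_mod_cast hp1.ne') Complex.I_ne_zero),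
      Complex.log_ofReal_mul hp1 Complex.I_ne_zero, add_mul, Complex.exp_add,
      ← Complex.cpow_def_of_ne_zero Complex.I_ne_zero, Complex.ofReal_log hp1.le,
      ← Complex.cpow_def_of_ne_zero (by exact_mod_cast hp1.ne'), ← Complex.ofReal_cpow hp1.le,
      one_div]
    rw [show (((γ : ℝ) + 1 : ℝ) : ℂ) = ((γ : ℝ) : ℂ) + 1 by push_cast; rfl,
      Complex.cpow_add _ _ Complex.I_ne_zero, Complex.cpow_one]
    ring
  rw [h2, h3]
  push_cast
  field_simp

/-- Near infinity in the lower half-plane, the Cauchy transform is the generating function of the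
complex moments. -/
theorem IsComplexMomentFamily.invCauchyTransform_eq [IsFiniteMeasure μ] (hS : IsExponentSet S c)
    (h : IsComplexMomentFamily S μ m) {A ρ : ℝ} (hA : 0 < A)
    (hm : ∀ γ : S, ‖m γ‖ ≤ A ^ (γ : ℝ)) (hρ : c * A < ρ) {u : ℂ} (hu : 0 < u.im)
    (huρ : ‖u‖ < ρ⁻¹) :
    invCauchyTransform μ u = ∑' γ : S, m γ * u ^ (((γ : ℝ) + 1 : ℝ) : ℂ) := by
  have hρ0 : 0 < ρ := (mul_pos hS.pos hA).trans hρ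
  -- Both sides are analytic on this convex half-disc, where the principal powers have no branch
  -- cut.
  set U : Set ℂ := {u | 0 < u.im} ∩ Metric.ball 0 ρ⁻¹ with hU
  have hUo : IsOpen U := (isOpen_lt continuous_const Complex.continuous_im).inter Metric.isOpen_ball
  have hUc : IsPreconnected U :=
    ((convex_halfSpace_im_gt 0).inter (convex_ball _ _)).isPreconnected
  have h1 : AnalyticOnNhd ℂ (invCauchyTransform μ) U :=
    (differentiableOn_invCauchyTransform.mono Set.inter_subset_left).analyticOnNhd hUo
  have h2 : AnalyticOnNhd ℂ (fun u => ∑' γ : S, m γ * u ^ (((γ : ℝ) + 1 : ℝ) : ℂ)) U := by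
    refine DifferentiableOn.analyticOnNhd (Complex.differentiableOn_tsum_of_summable_norm
      (hS.summable_div_rpow hA hρ) (fun γ => ?_) hUo fun γ w hw =>
        norm_mul_cpow_le hS hm hA hρ0 (mem_ball_zero_iff.1 hw.2).le γ) hUo
    intro w hw
    refine DifferentiableAt.differentiableWithinAt (DifferentiableAt.const_mul ?_ _)
    refine differentiableAt_id.cpow_const (Or.inr ?_)
    exact ne_of_gt hw.1
  have hmem : Complex.I * ((2 * ρ)⁻¹ : ℝ) ∈ U := by
    have hpos : 0 < (2 * ρ)⁻¹ := by positivity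
    refine ⟨by simpa using hρ0, ?_⟩
    rw [mem_ball_zero_iff, norm_mul, Complex.norm_I, one_mul, Complex.norm_real,
      Real.norm_of_nonneg hpos.le]
    exact inv_strictAnti₀ hρ0 (by linarith)
  have key : ∀ p : ℝ, ρ < p → invCauchyTransform μ (Complex.I * (p⁻¹ : ℝ)) =
      ∑' γ : S, m γ * (Complex.I * (p⁻¹ : ℝ)) ^ (((γ : ℝ) + 1 : ℝ) : ℂ) := fun p hp => by
    rw [← integral_exp_neg_mul_charFun (hρ0.trans hp)]
    exact (hasSum_integral_exp_neg_mul hS hA hm (hρ.trans hp) h.2.2).tsum_eq.symm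
  refine h1.eqOn_of_preconnected_of_frequently_eq h2 hUc hmem ?_ ⟨hu, mem_ball_zero_iff.2 huρ⟩
  -- The points `i / p` of the imaginary axis, where equality is known, accumulate at `i / (2ρ)`, an
  -- interior point of `U`.
  have ht : Tendsto (fun p : ℝ => Complex.I * ((p⁻¹ : ℝ) : ℂ)) (𝓝[≠] (2 * ρ))
      (𝓝[≠] (Complex.I * ((2 * ρ)⁻¹ : ℝ))) := by
    refine tendsto_nhdsWithin_of_tendsto_nhds_of_eventually_within _ ?_ ?_
    · have h3 : ContinuousAt (fun p : ℝ => Complex.I * ((p⁻¹ : ℝ) : ℂ)) (2 * ρ) :=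
        continuousAt_const.mul (Complex.continuous_ofReal.continuousAt.comp
          (continuousAt_inv₀ (by positivity)))
      exact h3.tendsto.mono_left nhdsWithin_le_nhds
    · filter_upwards [self_mem_nhdsWithin] with p hp
      intro h4
      apply hp
      have h5 := mul_left_cancel₀ Complex.I_ne_zero h4
      exact inv_injective (Complex.ofReal_injective h5)
  refine ht.frequently (Eventually.frequently ?_)
  have h6 : Set.Ioi ρ ∈ 𝓝 (2 * ρ) := Ioi_mem_nhds (by linarith)
  filter_upwards [nhdsWithin_le_nhds h6] with p hp
  exact key p hp

end PowerLaw

/-! ### Stieltjes inversion and boundary values of the moment series. -/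

namespace PowerLaw

open Filter Topology

variable {S : AddSubsemigroup ℝ} {c : ℝ} {μ : Measure ℝ} {m : S → ℂ}

theorem inv_sub_mul_I_im_pos (x : ℝ) {ε : ℝ} (hε : 0 < ε) : 0 < ((x - ε * Complex.I : ℂ)⁻¹).im := by
  rw [Complex.inv_im]
  have : 0 < Complex.normSq (x - ε * Complex.I) := by
    rw [Complex.normSq_pos]
    intro h
    have := congrArg Complex.im h
    simp at this
    exact hε.ne' this
  have h1 : -(x - ε * Complex.I : ℂ).im = ε := by simp
  rw [h1]
  positivity

/-- With `u = 1 / (x - iε)` the kernel is `1 / (x - t - iε)`, whose imaginary part is `π` times the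
Poisson kernel. -/
theorem im_inv_div_one_sub (x t : ℝ) {ε : ℝ} (hε : 0 < ε) :
    ((x - ε * Complex.I : ℂ)⁻¹ / (1 - (x - ε * Complex.I : ℂ)⁻¹ * t)).im =
      ε / ((x - t) ^ 2 + ε ^ 2) := by
  have h0 : ∀ y : ℝ, (y - ε * Complex.I : ℂ) ≠ 0 := fun y h => by
    have := congrArg Complex.im h
    simp at this
    exact hε.ne' this
  have h1 : (x - ε * Complex.I : ℂ)⁻¹ / (1 - (x - ε * Complex.I : ℂ)⁻¹ * t) =
      (((x - t : ℝ) : ℂ) - ε * Complex.I)⁻¹ := by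
    have h2 := h0 x
    have h3 := h0 (x - t)
    have h4 : (1 - (x - ε * Complex.I : ℂ)⁻¹ * t) =
        (((x - t : ℝ) : ℂ) - ε * Complex.I) / (x - ε * Complex.I) := by
      rw [eq_div_iff h2, sub_mul, mul_assoc, mul_comm (t : ℂ), ← mul_assoc, inv_mul_cancel₀ h2]
      push_cast
      ring
    rw [h4]
    field_simp
  rw [h1, Complex.inv_im, Complex.normSq_apply]
  simp [sq]

theorem im_invCauchyTransform [IsFiniteMeasure μ] (x : ℝ) {ε : ℝ} (hε : 0 < ε) :
    (invCauchyTransform μ (x - ε * Complex.I : ℂ)⁻¹).im = ∫ t, ε / ((x - t) ^ 2 + ε ^ 2) ∂μ := by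
  rw [invCauchyTransform, ← RCLike.im_to_complex,
    ← integral_im (integrable_div_one_sub_mul (inv_sub_mul_I_im_pos x hε))]
  simp only [RCLike.im_to_complex, im_inv_div_one_sub x _ hε]

theorem integral_mul_poisson (h : ℝ → ℝ) (t : ℝ) {ε : ℝ} (hε : 0 < ε) :
    ∫ x, h x * (ε / ((x - t) ^ 2 + ε ^ 2)) = ∫ s, h (t + ε * s) * (1 + s ^ 2)⁻¹ := by
  set g : ℝ → ℝ := fun x => h x * (ε / ((x - t) ^ 2 + ε ^ 2)) with hg
  have h1 := Measure.integral_comp_mul_left (fun y => g (t + y)) ε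
  rw [integral_add_left_eq_self g t, abs_of_pos (inv_pos.2 hε), smul_eq_mul,
    eq_inv_mul_iff_mul_eq₀ hε.ne', ← integral_const_mul] at h1
  rw [← h1]
  congr 1
  ext s
  simp only [hg, add_sub_cancel_left]
  have : 0 < 1 + s ^ 2 := by positivity
  field_simp
  ring

/-- Stieltjes inversion. -/
theorem tendsto_integral_mul_im_invCauchyTransform [IsFiniteMeasure μ] {h : ℝ → ℝ}
    (hc : Continuous h) (hs : HasCompactSupport h) :
    Tendsto (fun ε : ℝ => ∫ x : ℝ, h x * (invCauchyTransform μ (x - ε * Complex.I : ℂ)⁻¹).im)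
      (𝓝[>] 0) (𝓝 (Real.pi * ∫ x, h x ∂μ)) := by
  obtain ⟨C, hC⟩ := hc.bounded_above_of_compact_support hs
  -- Fubini and the substitution `x = t + εs` move `ε` into the argument of `h`, leaving the fixed
  -- weight `(1 + s²)⁻¹` of mass `π`.
  have hfub : ∀ ε : ℝ, 0 < ε →
      ∫ x : ℝ, h x * (invCauchyTransform μ (x - ε * Complex.I : ℂ)⁻¹).im =
        ∫ t, (∫ s, h (t + ε * s) * (1 + s ^ 2)⁻¹) ∂μ := fun ε hε => by
    have hpos : ∀ x t : ℝ, 0 < (x - t) ^ 2 + ε ^ 2 := fun x t => by positivity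
    have hint : Integrable (Function.uncurry fun (x t : ℝ) => h x * (ε / ((x - t) ^ 2 + ε ^ 2)))
        (volume.prod μ) := by
      refine (((hc.integrable_of_hasCompactSupport hs).norm).mul_prod
        (integrable_const (ε⁻¹ : ℝ) (μ := μ))).mono'
        (Continuous.aestronglyMeasurable ?_) (ae_of_all _ fun q => ?_)
      · unfold Function.uncurry
        exact (hc.comp continuous_fst).mul (continuous_const.div (by fun_prop)
          fun q => (hpos _ _).ne')
      · simp only [Function.uncurry]
        rw [norm_mul, Real.norm_of_nonneg (div_nonneg hε.le (hpos _ _).le)]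
        refine mul_le_mul_of_nonneg_left ?_ (norm_nonneg _)
        rw [div_le_iff₀ (hpos _ _), inv_mul_eq_div, le_div_iff₀ hε]
        nlinarith [sq_nonneg (q.1 - q.2)]
    calc _ = ∫ x : ℝ, (∫ t, h x * (ε / ((x - t) ^ 2 + ε ^ 2)) ∂μ) := by
          congr 1
          ext x
          rw [im_invCauchyTransform x hε, integral_const_mul]
      _ = ∫ t, (∫ x : ℝ, h x * (ε / ((x - t) ^ 2 + ε ^ 2))) ∂μ := integral_integral_swap hint
      _ = _ := by simp only [integral_mul_poisson h _ hε]
  have hbd : ∀ t ε s : ℝ, ‖h (t + ε * s) * (1 + s ^ 2)⁻¹‖ ≤ C * (1 + s ^ 2)⁻¹ := fun t ε s => by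
    rw [norm_mul, Real.norm_of_nonneg (r := (1 + s ^ 2)⁻¹) (by positivity)]
    exact mul_le_mul_of_nonneg_right (hC _) (by positivity)
  have hib : Integrable fun s : ℝ => C * (1 + s ^ 2)⁻¹ := integrable_inv_one_add_sq.const_mul C
  have hci : Continuous fun s : ℝ => (1 + s ^ 2)⁻¹ :=
    Continuous.inv₀ (by fun_prop) fun s => by positivity
  have hcomp : ∀ f : ℝ → ℝ, Continuous f → Continuous fun s => h (f s) := fun f hf => hc.comp hf
  have hinner : ∀ t : ℝ, Tendsto (fun ε : ℝ => ∫ s, h (t + ε * s) * (1 + s ^ 2)⁻¹) (𝓝[>] 0)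
      (𝓝 (Real.pi * h t)) := fun t => by
    have h1 : ∫ s : ℝ, h t * (1 + s ^ 2)⁻¹ = Real.pi * h t := by
      rw [integral_const_mul, integral_univ_inv_one_add_sq, mul_comm]
    rw [← h1]
    refine tendsto_integral_filter_of_dominated_convergence (fun s => C * (1 + s ^ 2)⁻¹)
      (Eventually.of_forall fun ε => ?_) (Eventually.of_forall fun ε => ae_of_all _ (hbd t ε)) hib
      (ae_of_all _ fun s => ?_)
    · exact ((hcomp _ (by fun_prop)).mul hci).aestronglyMeasurable
    · have h2 : Continuous fun ε : ℝ => h (t + ε * s) * (1 + s ^ 2)⁻¹ :=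
        (hcomp _ (by fun_prop)).mul continuous_const
      have h3 := (h2.tendsto 0).mono_left (nhdsWithin_le_nhds (s := Set.Ioi 0))
      simpa using h3
  rw [← integral_const_mul]
  refine Tendsto.congr' (f₁ := fun ε => ∫ t, (∫ s, h (t + ε * s) * (1 + s ^ 2)⁻¹) ∂μ) ?_ ?_
  · filter_upwards [self_mem_nhdsWithin] with ε hε
    exact (hfub ε hε).symm
  · refine tendsto_integral_filter_of_dominated_convergence (fun _ => C * Real.pi)
      (Eventually.of_forall fun ε => ?_) (Eventually.of_forall fun ε => ae_of_all _ fun t => ?_)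
      (integrable_const _) (ae_of_all _ hinner)
    · refine Continuous.aestronglyMeasurable ?_
      refine continuous_of_dominated (fun t => ?_) (fun t => ae_of_all _ (hbd t ε)) hib
        (ae_of_all _ fun s => ?_)
      · exact ((hcomp _ (by fun_prop)).mul hci).aestronglyMeasurable
      · exact (hcomp _ (by fun_prop)).mul continuous_const
    · rw [← integral_univ_inv_one_add_sq, ← integral_const_mul]
      exact norm_integral_le_of_norm_le hib (ae_of_all _ (hbd t ε))

theorem norm_invPow (x s : ℝ) : ‖invPow x s‖ = |x| ^ (-s) := by
  unfold invPow
  split_ifs with h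
  · rw [Complex.norm_real, Real.norm_of_nonneg (by positivity), abs_of_pos h]
  · rw [norm_mul, Complex.norm_real, Real.norm_of_nonneg (by positivity), Complex.norm_exp]
    simp

theorem invPow_eq_cpow {x : ℝ} (hx : x ≠ 0) (s : ℝ) : invPow x s = ((x : ℂ)⁻¹) ^ (s : ℂ) := by
  unfold invPow
  split_ifs with h
  · rw [Real.rpow_neg h.le, ← Real.inv_rpow h.le, Complex.ofReal_cpow (by positivity),
      Complex.ofReal_inv]
  · have hneg : x < 0 := lt_of_le_of_ne (not_lt.1 h) hx
    have h1 : 0 < (-x)⁻¹ := by rw [inv_pos]; linarith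
    have h2 : (x : ℂ)⁻¹ = (((-x)⁻¹ : ℝ) : ℂ) * (-1) := by push_cast; rw [inv_neg]; ring
    rw [h2, Complex.cpow_def_of_ne_zero (mul_ne_zero (by exact_mod_cast h1.ne') (by simp)),
      Complex.log_ofReal_mul h1 (by simp), Complex.log_neg_one, add_mul, Complex.exp_add,
      Complex.ofReal_log h1.le, ← Complex.cpow_def_of_ne_zero (by exact_mod_cast h1.ne'),
      ← Complex.ofReal_cpow h1.le, abs_of_neg hneg, Real.rpow_neg (by linarith),
      ← Real.inv_rpow (by linarith), mul_comm]
    congr 2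
    ring

theorem continuousAt_invPow {x : ℝ} (hx : x ≠ 0) (s : ℝ) : ContinuousAt (fun x => invPow x s) x := by
  rcases hx.lt_or_gt with h | h
  · have h1 : ContinuousAt (fun x : ℝ =>
        Complex.exp (Complex.I * (s * Real.pi)) * ((|x| ^ (-s) : ℝ) : ℂ)) x :=
      continuousAt_const.mul (Complex.continuous_ofReal.continuousAt.comp
        (continuous_abs.continuousAt.rpow_const (Or.inl (abs_ne_zero.2 hx))))
    refine h1.congr ?_
    filter_upwards [Iio_mem_nhds h] with y hy
    rw [invPow, if_neg (not_lt.2 (le_of_lt hy))]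
  · have h1 : ContinuousAt (fun x : ℝ => ((x ^ (-s) : ℝ) : ℂ)) x :=
      Complex.continuous_ofReal.continuousAt.comp
        (Real.continuousAt_rpow_const _ _ (Or.inl hx))
    refine h1.congr ?_
    filter_upwards [Ioi_mem_nhds h] with y hy
    rw [invPow, if_pos (show 0 < y from hy)]

/-- The points `1 / (x - iε)` approach `1 / x` from the upper half-plane, and from that side the
principal logarithm is continuous up to the negative axis. Hence the phase `e ^ (iπs)` for `x < 0`.
-/
theorem tendsto_cpow_inv_sub_mul_I {x : ℝ} (hx : x ≠ 0) (s : ℝ) :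
    Tendsto (fun ε : ℝ => ((x - ε * Complex.I : ℂ)⁻¹) ^ (s : ℂ)) (𝓝[>] 0) (𝓝 (invPow x s)) := by
  rw [invPow_eq_cpow hx]
  have hx' : (x : ℂ)⁻¹ ≠ 0 := inv_ne_zero (by exact_mod_cast hx)
  have hw : Tendsto (fun ε : ℝ => (x - ε * Complex.I : ℂ)⁻¹) (𝓝[>] 0)
      (𝓝[{z | 0 ≤ z.im}] ((x : ℂ)⁻¹)) := by
    refine tendsto_nhdsWithin_of_tendsto_nhds_of_eventually_within _ ?_ ?_
    · have h1 : ContinuousAt (fun ε : ℝ => (x - ε * Complex.I : ℂ)⁻¹) 0 :=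
        ContinuousAt.inv₀ (by fun_prop) (by simpa using hx)
      have h2 := h1.tendsto.mono_left (nhdsWithin_le_nhds (s := Set.Ioi 0))
      simpa using h2
    · filter_upwards [self_mem_nhdsWithin] with ε hε
      exact (inv_sub_mul_I_im_pos x hε).le
  have hlog : ContinuousWithinAt Complex.log {z | 0 ≤ z.im} ((x : ℂ)⁻¹) := by
    rw [← Complex.ofReal_inv]
    rcases hx.lt_or_gt with h | h
    · exact Complex.continuousWithinAt_log_of_re_neg_of_im_zero
        (by simpa using h) (by simp)
    · exact (continuousAt_clog (Or.inl (by simpa using h))).continuousWithinAt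
  have h3 : Tendsto (fun ε : ℝ => Complex.exp (Complex.log (x - ε * Complex.I : ℂ)⁻¹ * s)) (𝓝[>] 0)
      (𝓝 (Complex.exp (Complex.log (x : ℂ)⁻¹ * s))) :=
    (Complex.continuous_exp.tendsto _).comp ((hlog.tendsto.comp hw).mul_const _)
  rw [Complex.cpow_def_of_ne_zero hx']
  refine h3.congr' ?_
  filter_upwards [self_mem_nhdsWithin] with ε hε
  rw [Complex.cpow_def_of_ne_zero]
  intro h
  have := inv_sub_mul_I_im_pos x hε
  rw [h] at this
  simp at this

theorem norm_mul_invPow_le {a : ℂ} {r R β x : ℝ} (hR : 0 < R) (hr : 0 ≤ r) (hβ : 0 ≤ β)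
    (ha : ‖a‖ ≤ r ^ β) (hx : R ≤ |x|) : ‖a * invPow x (β + 1)‖ ≤ (r / R) ^ β * R⁻¹ := by
  rw [norm_mul, norm_invPow]
  calc _ ≤ r ^ β * R ^ (-(β + 1)) := by
        exact mul_le_mul ha (Real.rpow_le_rpow_of_nonpos hR hx (by linarith)) (by positivity)
          (by positivity)
    _ = _ := by
        rw [neg_add, Real.rpow_add hR, Real.rpow_neg_one, Real.div_rpow hr hR.le, Real.rpow_neg hR.le]
        ring

theorem injective_pos_mem (S : AddSubsemigroup ℝ) :
    Function.Injective fun β : {β : ℝ // β ∈ S ∧ 0 < β} => (⟨β, β.2.1⟩ : S) := fun β β' h =>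
  Subtype.ext (by simpa using h)

theorem summable_pos_mem_of_summable {f : ℝ → ℝ} (h : Summable fun γ : S => f γ) :
    Summable fun β : {β : ℝ // β ∈ S ∧ 0 < β} => f β :=
  h.comp_injective (injective_pos_mem S)

theorem IsExponentSet.summable_div_rpow_pos_mem (hS : IsExponentSet S c) {A ρ : ℝ} (hA : 0 < A)
    (hρ : c * A < ρ) :
    Summable fun β : {β : ℝ // β ∈ S ∧ 0 < β} => (A / ρ) ^ (β : ℝ) * ρ⁻¹ :=
  summable_pos_mem_of_summable (f := fun γ => (A / ρ) ^ γ * ρ⁻¹) (hS.summable_div_rpow hA hρ)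

theorem continuousOn_tailDensity (hS : IsExponentSet S c) {a : ℝ → ℂ} {r R : ℝ} (hr : 0 < r)
    (hrR : c * r < R) (ha : ∀ β ∈ S, 0 < β → ‖a β‖ ≤ r ^ β) :
    ContinuousOn (tailDensity S a) {x | R ≤ |x|} := by
  have hR : 0 < R := (mul_pos hS.pos hr).trans hrR
  refine continuousOn_tsum (fun β x hx => ?_) (hS.summable_div_rpow_pos_mem hr hrR) fun β x hx => ?_
  · have hx0 : x ≠ 0 := fun h => by
      rw [h, Set.mem_ofPred_eq, abs_zero] at hx
      linarith
    exact (Complex.continuous_im.continuousAt.comp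
      (continuousAt_const.mul (continuousAt_invPow hx0 _))).continuousWithinAt
  · exact (Complex.abs_im_le_norm _).trans
      (norm_mul_invPow_le hR hr.le β.2.2.le (ha β β.2.1 β.2.2) hx)

open Classical in
/-- The coefficients `m_β / π` of the tail density of a measure with complex moments `m`. -/
noncomputable def tailCoeff (m : S → ℂ) (β : ℝ) : ℂ :=
  if h : β ∈ S then m ⟨β, h⟩ / Real.pi else 0

/-- The exponent `0` contributes `1 / x`, which is real; taking imaginary parts therefore leaves
only `β > 0`. -/
theorem tailDensity_tailCoeff (hS : IsExponentSet S c) {A ρ x : ℝ} (hA : 0 < A)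
    (hm : ∀ γ : S, ‖m γ‖ ≤ A ^ (γ : ℝ)) (hm0 : ∀ γ : S, (γ : ℝ) = 0 → m γ = 1)
    (hρ : c * A < ρ) (hx : ρ ≤ |x|) :
    (∑' γ : S, m γ * invPow x ((γ : ℝ) + 1)).im = Real.pi * tailDensity S (tailCoeff m) x := by
  have hρ0 : 0 < ρ := (mul_pos hS.pos hA).trans hρ
  have hx0 : x ≠ 0 := fun h => by
    rw [h, abs_zero] at hx
    linarith
  have hsum : Summable fun γ : S => m γ * invPow x ((γ : ℝ) + 1) :=
    Summable.of_norm_bounded (hS.summable_div_rpow hA hρ) fun γ =>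
      norm_mul_invPow_le hρ0 hA.le (hS.nonneg _ γ.2) (hm γ) hx
  rw [Complex.im_tsum hsum, tailDensity, ← tsum_mul_left]
  rw [← (injective_pos_mem S).tsum_eq]
  · refine tsum_congr fun β => ?_
    rw [tailCoeff, dif_pos β.2.1, div_mul_eq_mul_div, Complex.div_ofReal_im]
    field_simp
  · intro γ hγ
    by_contra hcon
    apply hγ
    have h0 : (γ : ℝ) = 0 := by
      refine le_antisymm (not_lt.1 fun h => hcon ⟨⟨γ, γ.2, h⟩, rfl⟩) (hS.nonneg _ γ.2)
    simp only [hm0 γ h0, h0, one_mul, zero_add]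
    rw [invPow_eq_cpow hx0, ← Complex.ofReal_inv]
    simp

end PowerLaw

/-! ### From an expansion to a power law tail. -/

namespace PowerLaw

open Filter Topology

variable {S : AddSubsemigroup ℝ} {c : ℝ} {μ : Measure ℝ} {m : S → ℂ}

theorem continuous_invCauchyTransform_inv_sub [IsFiniteMeasure μ] {ε : ℝ} (hε : 0 < ε) :
    Continuous fun x : ℝ => invCauchyTransform μ (x - ε * Complex.I : ℂ)⁻¹ := by
  refine (differentiableOn_invCauchyTransform (μ := μ)).continuousOn.comp_continuous
    (Continuous.inv₀ (by fun_prop) fun x h => ?_) fun x => inv_sub_mul_I_im_pos x hε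
  have := inv_sub_mul_I_im_pos x hε
  rw [h] at this
  simp at this

theorem norm_inv_sub_mul_I_lt {x ρ : ℝ} (hρ : 0 < ρ) (hx : ρ < |x|) (ε : ℝ) :
    ‖(x - ε * Complex.I : ℂ)⁻¹‖ < ρ⁻¹ := by
  rw [norm_inv]
  refine inv_strictAnti₀ hρ (hx.trans_le ?_)
  simpa using Complex.abs_re_le_norm (x - ε * Complex.I)

theorem norm_tailCoeff_le {A β : ℝ} (hm : ∀ γ : S, ‖m γ‖ ≤ A ^ (γ : ℝ)) (hβ : β ∈ S) :
    ‖tailCoeff m β‖ ≤ A ^ β := by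
  rw [tailCoeff, dif_pos hβ, norm_div, Complex.norm_real, Real.norm_of_nonneg Real.pi_pos.le]
  exact (div_le_self (norm_nonneg _) (by linarith [Real.pi_gt_three])).trans (hm _)

namespace IsComplexMomentFamily

theorem tendsto_im_invCauchyTransform [IsFiniteMeasure μ] (hS : IsExponentSet S c)
    (h : IsComplexMomentFamily S μ m) {A ρ x : ℝ} (hA : 0 < A)
    (hm : ∀ γ : S, ‖m γ‖ ≤ A ^ (γ : ℝ)) (hρ : c * A < ρ) (hx : ρ < |x|) :
    Tendsto (fun ε : ℝ => (invCauchyTransform μ (x - ε * Complex.I : ℂ)⁻¹).im) (𝓝[>] 0)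
      (𝓝 (Real.pi * tailDensity S (tailCoeff m) x)) := by
  have hρ0 : 0 < ρ := (mul_pos hS.pos hA).trans hρ
  have hx0 : x ≠ 0 := fun h => by
    rw [h, abs_zero] at hx
    linarith
  rw [← tailDensity_tailCoeff hS hA hm h.2.1 hρ hx.le]
  refine (Complex.continuous_im.tendsto _).comp ?_
  have h1 : Tendsto (fun ε : ℝ =>
      ∑' γ : S, m γ * (x - ε * Complex.I : ℂ)⁻¹ ^ (((γ : ℝ) + 1 : ℝ) : ℂ)) (𝓝[>] 0)
      (𝓝 (∑' γ : S, m γ * invPow x ((γ : ℝ) + 1))) :=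
    tendsto_tsum_of_dominated_convergence (hS.summable_div_rpow hA hρ)
      (fun γ => (tendsto_cpow_inv_sub_mul_I hx0 _).const_mul _)
      (Eventually.of_forall fun ε γ =>
        norm_mul_cpow_le hS hm hA hρ0 (norm_inv_sub_mul_I_lt hρ0 hx ε).le γ)
  refine h1.congr' ?_
  filter_upwards [self_mem_nhdsWithin] with ε hε
  exact (h.invCauchyTransform_eq hS hA hm hρ (inv_sub_mul_I_im_pos x hε)
    (norm_inv_sub_mul_I_lt hρ0 hx ε)).symm

/-- Up to the factor `π`, the density is a limit of integrals of the positive kernel `ε / ((x - t)²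
+ ε²)`. -/
theorem tailDensity_nonneg [IsFiniteMeasure μ] (hS : IsExponentSet S c)
    (h : IsComplexMomentFamily S μ m) {A ρ x : ℝ} (hA : 0 < A)
    (hm : ∀ γ : S, ‖m γ‖ ≤ A ^ (γ : ℝ)) (hρ : c * A < ρ) (hx : ρ < |x|) :
    0 ≤ tailDensity S (tailCoeff m) x := by
  have h1 : 0 ≤ Real.pi * tailDensity S (tailCoeff m) x := by
    refine ge_of_tendsto (h.tendsto_im_invCauchyTransform hS hA hm hρ hx) ?_
    filter_upwards [self_mem_nhdsWithin] with ε hε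
    have hε : 0 < ε := hε
    rw [im_invCauchyTransform x hε]
    exact integral_nonneg fun t => by positivity
  exact nonneg_of_mul_nonneg_right h1 Real.pi_pos

/-- The same integrals have two limits: Stieltjes inversion gives `π ∫ f dμ`, and dominated
convergence, valid since `f` lives where the series converges uniformly, gives the integral against
the density. -/
theorem integral_eq [IsFiniteMeasure μ] (hS : IsExponentSet S c)
    (h : IsComplexMomentFamily S μ m) {A ρ : ℝ} (hA : 0 < A)
    (hm : ∀ γ : S, ‖m γ‖ ≤ A ^ (γ : ℝ)) (hρ : c * A < ρ) {f : ℝ → ℝ} (hc : Continuous f)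
    (hs : HasCompactSupport f) (hf : ∀ x, |x| ≤ ρ → f x = 0) :
    ∫ x, f x ∂μ = ∫ x, f x * tailDensity S (tailCoeff m) x := by
  have hρ0 : 0 < ρ := (mul_pos hS.pos hA).trans hρ
  have h1 := tendsto_integral_mul_im_invCauchyTransform (μ := μ) hc hs
  have h2 : Tendsto (fun ε : ℝ => ∫ x : ℝ, f x *
      (invCauchyTransform μ (x - ε * Complex.I : ℂ)⁻¹).im) (𝓝[>] 0)
      (𝓝 (∫ x : ℝ, f x * (Real.pi * tailDensity S (tailCoeff m) x))) := by
    refine tendsto_integral_filter_of_dominated_convergence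
      (fun x => ‖f x‖ * ∑' γ : S, (A / ρ) ^ (γ : ℝ) * ρ⁻¹) ?_ ?_
      ((hc.integrable_of_hasCompactSupport hs).norm.mul_const _) (ae_of_all _ fun x => ?_)
    · filter_upwards [self_mem_nhdsWithin] with ε hε
      exact (hc.mul (Complex.continuous_im.comp
        (continuous_invCauchyTransform_inv_sub hε))).aestronglyMeasurable
    · filter_upwards [self_mem_nhdsWithin] with ε hε
      refine ae_of_all _ fun x => ?_
      rcases le_or_gt |x| ρ with hx | hx
      · simp [hf x hx]
      · rw [norm_mul]
        refine mul_le_mul_of_nonneg_left ((Complex.abs_im_le_norm _).trans ?_) (norm_nonneg _)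
        rw [h.invCauchyTransform_eq hS hA hm hρ (inv_sub_mul_I_im_pos x hε)
          (norm_inv_sub_mul_I_lt hρ0 hx ε)]
        exact tsum_of_norm_bounded (hS.summable_div_rpow hA hρ).hasSum fun γ =>
          norm_mul_cpow_le hS hm hA hρ0 (norm_inv_sub_mul_I_lt hρ0 hx ε).le γ
    · rcases le_or_gt |x| ρ with hx | hx
      · simp [hf x hx]
      · exact (h.tendsto_im_invCauchyTransform hS hA hm hρ hx).const_mul _
  have h3 := tendsto_nhds_unique h1 h2
  have h4 : ∫ x : ℝ, f x * (Real.pi * tailDensity S (tailCoeff m) x) =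
      Real.pi * ∫ x, f x * tailDensity S (tailCoeff m) x := by
    rw [← integral_const_mul]
    congr 1
    ext x
    ring
  rw [h4] at h3
  exact mul_left_cancel₀ Real.pi_pos.ne' h3

/-- A probability measure whose Fourier transform has an expansion with exponents in `S` belongs to
the power law class. -/
theorem mem_powerLawClass [IsProbabilityMeasure μ] (hS : IsExponentSet S c)
    (h : IsComplexMomentFamily S μ m) : μ ∈ powerLawClass S c := by
  obtain ⟨A, hA, hm⟩ := h.exists_norm_le hS
  have hcpos := hS.pos
  have hcA : 0 < c * A := mul_pos hcpos hA
  set ρ := 2 * (c * A) with hρdef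
  have hρ : c * A < ρ := by linarith
  have hρ0 : 0 < ρ := by linarith
  set D := tailDensity S (tailCoeff m) with hD
  set R := ρ + 2 with hR
  have hDc : ContinuousOn D {x | ρ ≤ |x|} :=
    continuousOn_tailDensity hS hA hρ fun β hβ _ => norm_tailCoeff_le hm hβ
  have hD0 : ∀ x, ρ < |x| → 0 ≤ D x := fun x hx => h.tailDensity_nonneg hS hA hm hρ hx
  refine ⟨inferInstance, tailCoeff m, A, R, hA, by linarith,
    fun β hβ _ => norm_tailCoeff_le hm hβ, ?_, fun x hx => hD0 x (by linarith), ?_⟩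
  · rw [lt_inv_mul_iff₀ hcpos]
    linarith
  -- The cutoff vanishes for `|x| ≤ ρ + 1` and equals `1` for `|x| ≥ R = ρ + 2`. It makes `χ * D`
  -- continuous and nonnegative on the whole line, so `μ` and the density can be compared as
  -- measures.
  set χ : ℝ → ℝ := fun x => max 0 (min 1 (|x| - (ρ + 1))) with hχ
  have hχc : Continuous χ := by fun_prop
  have hχ0 : ∀ x, 0 ≤ χ x := fun x => le_max_left _ _
  have hχz : ∀ x, |x| ≤ ρ + 1 → χ x = 0 := fun x hx => by
    rw [hχ]
    exact max_eq_left ((min_le_right _ _).trans (by linarith))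
  have hχ1 : ∀ x, R ≤ |x| → χ x = 1 := fun x hx => by
    simp only [hχ]
    rw [min_eq_left (by linarith), max_eq_right zero_le_one]
  have hχDc : Continuous fun x => χ x * D x := by
    refine continuous_iff_continuousAt.2 fun x => ?_
    rcases lt_or_ge ρ |x| with hx | hx
    · refine hχc.continuousAt.mul (hDc.continuousAt ?_)
      filter_upwards [continuous_abs.continuousAt.eventually (lt_mem_nhds hx)] with y hy
      exact le_of_lt hy
    · refine (continuousAt_const (y := (0 : ℝ))).congr ?_
      filter_upwards [continuous_abs.continuousAt.eventually
        (gt_mem_nhds (show |x| < ρ + 1 by linarith))] with y hy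
      rw [hχz y (le_of_lt hy), zero_mul]
  have hχD0 : ∀ x, 0 ≤ χ x * D x := fun x => by
    rcases lt_or_ge ρ |x| with hx | hx
    · exact mul_nonneg (hχ0 x) (hD0 x hx)
    · rw [hχz x (by linarith), zero_mul]
  have hm1 : Measurable fun x => ENNReal.ofReal (χ x) := hχc.measurable.ennreal_ofReal
  have hm2 : Measurable fun x => ENNReal.ofReal (χ x * D x) := hχDc.measurable.ennreal_ofReal
  have hlf1 : IsLocallyFiniteMeasure (μ.withDensity fun x => ENNReal.ofReal (χ x)) :=
    IsLocallyFiniteMeasure.withDensity_ofReal hχc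
  have hlf2 : IsLocallyFiniteMeasure (volume.withDensity fun x => ENNReal.ofReal (χ x * D x)) :=
    IsLocallyFiniteMeasure.withDensity_ofReal hχDc
  have heq : (μ.withDensity fun x => ENNReal.ofReal (χ x)) =
      volume.withDensity fun x => ENNReal.ofReal (χ x * D x) := by
    refine Measure.ext_of_integral_eq_on_compactlySupported fun f => ?_
    rw [integral_withDensity_eq_integral_toReal_smul hm1 (ae_of_all _ fun _ => ENNReal.ofReal_lt_top),
      integral_withDensity_eq_integral_toReal_smul hm2 (ae_of_all _ fun _ => ENNReal.ofReal_lt_top)]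
    simp only [ENNReal.toReal_ofReal (hχ0 _), ENNReal.toReal_ofReal (hχD0 _), smul_eq_mul]
    have hfs : HasCompactSupport fun x => χ x * f x := f.hasCompactSupport.mul_left
    rw [h.integral_eq hS hA hm hρ (f := fun x => χ x * f x) (hχc.mul f.continuous) hfs
      fun x hx => by rw [hχz x (by linarith), zero_mul]]
    congr 1
    ext x
    ring
  have hT : MeasurableSet {x : ℝ | R ≤ |x|} := measurableSet_le measurable_const measurable_abs
  have h1 := congrArg (fun ν : Measure ℝ => ν.restrict {x : ℝ | R ≤ |x|}) heq
  simp only [restrict_withDensity hT] at h1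
  calc μ.restrict {x | R ≤ |x|} =
        (μ.restrict {x | R ≤ |x|}).withDensity fun x => ENNReal.ofReal (χ x) := by
        conv_lhs => rw [← withDensity_one (μ := μ.restrict {x | R ≤ |x|})]
        refine withDensity_congr_ae ?_
        filter_upwards [ae_restrict_mem hT] with x hx
        rw [hχ1 x hx]
        simp
    _ = _ := h1
    _ = _ := by
        refine withDensity_congr_ae ?_
        filter_upwards [ae_restrict_mem hT] with x hx
        rw [hχ1 x hx, one_mul]

end IsComplexMomentFamily

end PowerLaw

/-! ### Fourier integrals of two-sided power tails. -/

namespace PowerLaw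

open Filter Topology

/-- The integrand `(p e^{iu} + q e^{-iu}) u^{-β-1}` of the Fourier transform of a two-sided power
tail. -/
noncomputable def fourierKernel (p q β u : ℝ) : ℂ :=
  (p * Complex.exp (Complex.I * u) + q * Complex.exp (-(Complex.I * u))) *
    ((u ^ (-(β + 1)) : ℝ) : ℂ)

/-- The coefficients of the primitive `∑ e_n i^n u^{n-β} / n!` of `fourierKernel p q β`. -/
noncomputable def primitiveCoeff (p q β : ℝ) (n : ℕ) : ℝ :=
  (p + (-1) ^ n * q) / (n - β)

variable {p q β : ℝ}

theorem norm_exp_neg_I_mul_ofReal (u : ℝ) : ‖Complex.exp (-(Complex.I * u))‖ = 1 := by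
  simp [Complex.norm_exp]

theorem norm_fourierKernel_le {u : ℝ} (hu : 0 < u) :
    ‖fourierKernel p q β u‖ ≤ (|p| + |q|) * u ^ (-(β + 1)) := by
  rw [fourierKernel, norm_mul, Complex.norm_real, Real.norm_of_nonneg (r := u ^ (-(β + 1)))
    (by positivity)]
  refine mul_le_mul_of_nonneg_right ((norm_add_le _ _).trans ?_) (by positivity)
  simp [norm_exp_neg_I_mul_ofReal]

theorem measurable_fourierKernel : Measurable (fourierKernel p q β) := by
  unfold fourierKernel
  refine Measurable.mul (Continuous.measurable (by fun_prop)) ?_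
  exact Complex.measurable_ofReal.comp (measurable_id.pow_const _)

theorem integrableOn_fourierKernel (hβ : 0 < β) {u : ℝ} (hu : 0 < u) :
    IntegrableOn (fourierKernel p q β) (Set.Ioi u) := by
  refine Integrable.mono' ((integrableOn_Ioi_rpow_of_lt (a := -(β + 1)) (by linarith) hu).const_mul
    (|p| + |q|)) measurable_fourierKernel.aestronglyMeasurable ?_
  filter_upwards [ae_restrict_mem measurableSet_Ioi] with x hx
  exact norm_fourierKernel_le (hu.trans hx)

theorem hasSum_fourierKernel {u : ℝ} (hu : 0 < u) :
    HasSum (fun n : ℕ => ((p + (-1) ^ n * q : ℝ) : ℂ) * Complex.I ^ n / n.factorial *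
      ((u ^ ((n : ℝ) - β - 1) : ℝ) : ℂ)) (fourierKernel p q β u) := by
  have h1 := NormedSpace.expSeries_div_hasSum_exp (Complex.I * u)
  have h2 := NormedSpace.expSeries_div_hasSum_exp (-(Complex.I * u))
  rw [← Complex.exp_eq_exp_ℂ] at h1 h2
  refine (((h1.mul_left (p : ℂ)).add (h2.mul_left (q : ℂ))).mul_right
    ((u ^ (-(β + 1)) : ℝ) : ℂ)).congr_fun fun n => ?_
  have h3 : u ^ ((n : ℝ) - β - 1) = u ^ n * u ^ (-(β + 1)) := by
    rw [← Real.rpow_natCast u n, ← Real.rpow_add hu]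
    ring_nf
  rw [h3, neg_pow (Complex.I * u), mul_pow]
  push_cast
  ring

/-- Termwise integration of the exponential series. The hypothesis `hpq` removes the term in `x⁻¹`
when `β` is an integer, hence the logarithm; the convention `0 / 0 = 0` then makes the corresponding
`primitiveCoeff` zero, as needed. -/
theorem hasSum_intervalIntegral_fourierKernel (hpq : ∀ n : ℕ, (n : ℝ) = β → p + (-1) ^ n * q = 0)
    {u v : ℝ} (hu : 0 < u) (hv : 0 < v) :
    HasSum (fun n : ℕ => (primitiveCoeff p q β n : ℂ) * Complex.I ^ n / n.factorial *
      ((v ^ ((n : ℝ) - β) - u ^ ((n : ℝ) - β) : ℝ) : ℂ)) (∫ x in u..v, fourierKernel p q β x) := by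
  have hpos : ∀ x ∈ Set.uIoc u v, 0 < x := fun x hx => (lt_min hu hv).trans hx.1
  set w := min u v with hw
  have hw0 : 0 < w := lt_min hu hv
  have hV0 : 0 < max u v := hu.trans_le (le_max_left _ _)
  set B : ℕ → ℝ := fun n => (|p| + |q|) * ((max u v) ^ n / n.factorial) *
    max (w ^ (-(β + 1))) ((max u v) ^ (-(β + 1))) with hB
  have hBs : Summable B :=
    ((Real.summable_pow_div_factorial _).mul_left _).mul_right _
  have h := intervalIntegral.hasSum_integral_of_dominated_convergence (μ := volume) (a := u) (b := v)
    (F := fun (n : ℕ) (x : ℝ) => ((p + (-1) ^ n * q : ℝ) : ℂ) * Complex.I ^ n / n.factorial *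
      ((x ^ ((n : ℝ) - β - 1) : ℝ) : ℂ)) (f := fourierKernel p q β) (fun n _ => B n)
    (fun n => (measurable_const.mul (Complex.measurable_ofReal.comp
      (measurable_id.pow_const _))).aestronglyMeasurable)
    (fun n => ae_of_all _ fun x hx => ?_) (ae_of_all _ fun x hx => hBs) (by simp)
    (ae_of_all _ fun x hx => hasSum_fourierKernel (hpos x hx))
  · refine h.congr_fun fun n => ?_
    have h1 : ∫ x in u..v, ((p + (-1) ^ n * q : ℝ) : ℂ) * Complex.I ^ n / n.factorial *
        ((x ^ ((n : ℝ) - β - 1) : ℝ) : ℂ) = ((p + (-1) ^ n * q : ℝ) : ℂ) * Complex.I ^ n /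
          n.factorial * ((∫ x in u..v, x ^ ((n : ℝ) - β - 1) : ℝ) : ℂ) := by
      rw [intervalIntegral.integral_const_mul, intervalIntegral.integral_ofReal]
    rw [h1]
    by_cases hn : (n : ℝ) = β
    · rw [primitiveCoeff, hpq n hn]
      simp
    · have hne : (n : ℝ) - β ≠ 0 := sub_ne_zero.2 hn
      rw [integral_rpow (Or.inr ⟨fun h => hne (by linarith), Set.notMem_uIcc_of_lt hu hv⟩),
        sub_add_cancel, primitiveCoeff]
      have hne' : ((n : ℂ) - β) ≠ 0 := by exact_mod_cast hne
      push_cast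
      field_simp
  · have hx0 := hpos x hx
    have hx1 : w ≤ x := hx.1.le
    have hx2 : x ≤ max u v := hx.2
    have h3 : x ^ ((n : ℝ) - β - 1) = x ^ n * x ^ (-(β + 1)) := by
      rw [← Real.rpow_natCast x n, ← Real.rpow_add hx0]
      ring_nf
    have h4 : x ^ (-(β + 1)) ≤ max (w ^ (-(β + 1))) ((max u v) ^ (-(β + 1))) := by
      rcases le_total (-(β + 1)) 0 with hβ | hβ
      · exact (Real.rpow_le_rpow_of_nonpos hw0 hx1 hβ).trans (le_max_left _ _)
      · exact (Real.rpow_le_rpow hx0.le hx2 hβ).trans (le_max_right _ _)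
    have h5 : |p + (-1) ^ n * q| ≤ |p| + |q| := by
      refine (abs_add_le _ _).trans ?_
      rw [abs_mul, abs_pow, abs_neg, abs_one, one_pow, one_mul]
    rw [norm_mul, norm_div, norm_mul, norm_pow, Complex.norm_I, one_pow, mul_one,
      Complex.norm_real, Complex.norm_real, Complex.norm_natCast, Real.norm_eq_abs, h3,
      Real.norm_of_nonneg (by positivity)]
    calc _ = |p + (-1) ^ n * q| * (x ^ n / n.factorial) * x ^ (-(β + 1)) := by ring
      _ ≤ _ := by
        simp only [hB]
        gcongr

theorem summable_primitive {B : ℝ} (hB : ∀ n, |primitiveCoeff p q β n| ≤ B) {u : ℝ} (hu : 0 < u) :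
    Summable fun n : ℕ => (primitiveCoeff p q β n : ℂ) * Complex.I ^ n / n.factorial *
      ((u ^ ((n : ℝ) - β) : ℝ) : ℂ) := by
  refine Summable.of_norm_bounded (((Real.summable_pow_div_factorial u).mul_left B).mul_right
    (u ^ (-β))) fun n => ?_
  have h3 : u ^ ((n : ℝ) - β) = u ^ n * u ^ (-β) := by
    rw [← Real.rpow_natCast u n, ← Real.rpow_add hu]
    ring_nf
  rw [norm_mul, norm_div, norm_mul, norm_pow, Complex.norm_I, one_pow, mul_one,
    Complex.norm_real, Complex.norm_real, Complex.norm_natCast, Real.norm_eq_abs, h3,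
    Real.norm_of_nonneg (by positivity)]
  calc _ = |primitiveCoeff p q β n| * (u ^ n / n.factorial) * u ^ (-β) := by ring
    _ ≤ _ := by gcongr; exact hB n

theorem exists_integral_Ioi_fourierKernel (hβ : 0 < β)
    (hpq : ∀ n : ℕ, (n : ℝ) = β → p + (-1) ^ n * q = 0)
    {B : ℝ} (hB : ∀ n, |primitiveCoeff p q β n| ≤ B) :
    ∃ K : ℂ, ∀ u : ℝ, 0 < u → ∫ x in Set.Ioi u, fourierKernel p q β x =
      K - ∑' n : ℕ, (primitiveCoeff p q β n : ℂ) * Complex.I ^ n / n.factorial *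
        ((u ^ ((n : ℝ) - β) : ℝ) : ℂ) := by
  -- The constant is fixed by splitting the integral at `1`.
  refine ⟨(∫ x in Set.Ioi 1, fourierKernel p q β x) + ∑' n : ℕ,
    (primitiveCoeff p q β n : ℂ) * Complex.I ^ n / n.factorial *
        (((1 : ℝ) ^ ((n : ℝ) - β) : ℝ) : ℂ), fun u hu => ?_⟩
  rw [← intervalIntegral.integral_interval_add_Ioi (integrableOn_fourierKernel hβ hu)
    (integrableOn_fourierKernel hβ one_pos),
    ← (hasSum_intervalIntegral_fourierKernel hpq hu one_pos).tsum_eq, add_sub_assoc, add_comm,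
    ← (summable_primitive hB one_pos).tsum_sub (summable_primitive hB hu)]
  congr 1
  refine tsum_congr fun n => ?_
  push_cast
  ring

theorem setOf_le_abs (R : ℝ) : {x : ℝ | R ≤ |x|} = Set.Iic (-R) ∪ Set.Ici R := by
  ext x
  simp only [Set.mem_ofPred_eq, Set.mem_union, Set.mem_Iic, Set.mem_Ici, le_abs]
  constructor <;> rintro (h | h)
  · exact Or.inr h
  · exact Or.inl (by linarith)
  · exact Or.inr (by linarith)
  · exact Or.inl h

theorem integrableOn_le_abs {E : Type*} [NormedAddCommGroup E] {R : ℝ} {f : ℝ → E}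
    (h : IntegrableOn f (Set.Ioi R)) (h' : IntegrableOn (fun x => f (-x)) (Set.Ioi R)) :
    IntegrableOn f {x | R ≤ |x|} := by
  rw [setOf_le_abs]
  refine IntegrableOn.union ?_ ((integrableOn_Ici_iff_integrableOn_Ioi).2 h)
  have h2 : IntegrableOn (fun x => f (-x)) (Set.Ioi (-(-R))) := by rwa [neg_neg]
  rw [integrableOn_Iic_iff_integrableOn_Iio]
  simpa using h2.comp_neg_Iio

theorem setIntegral_le_abs {E : Type*} [NormedAddCommGroup E] [NormedSpace ℝ E] {R : ℝ}
    (hR : 0 < R) {f : ℝ → E} (h : IntegrableOn f (Set.Ioi R))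
    (h' : IntegrableOn (fun x => f (-x)) (Set.Ioi R)) :
    ∫ x in {x | R ≤ |x|}, f x = ∫ x in Set.Ioi R, (f x + f (-x)) := by
  have hi := integrableOn_le_abs h h'
  rw [setOf_le_abs, integrableOn_union] at hi
  have hd : Disjoint (Set.Iic (-R)) (Set.Ici R) := by
    rw [Set.disjoint_left]
    intro x hx hx'
    have h1 : x ≤ -R := hx
    have h2 : R ≤ x := hx'
    linarith
  rw [setOf_le_abs, setIntegral_union hd measurableSet_Ici hi.1 hi.2, integral_add h h',
    integral_Ici_eq_integral_Ioi, integral_comp_neg_Ioi, add_comm]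

end PowerLaw

/-! ### The Fourier transform of a single tail term. -/

namespace PowerLaw

open Filter Topology

/-- The term `Im (a (1 / x) ^ (β + 1))` of a tail density. -/
noncomputable def tailTerm (a : ℂ) (β x : ℝ) : ℝ := (a * invPow x (β + 1)).im

/-- The coefficient of the tail term `Im (a (1 / x) ^ (β + 1))` on the negative half-line. -/
noncomputable def negCoeff (a : ℂ) (β : ℝ) : ℝ :=
  (a * Complex.exp (Complex.I * (((β + 1 : ℝ) : ℂ) * Real.pi))).im

variable {a : ℂ} {β R : ℝ}

theorem tailTerm_of_pos {x : ℝ} (hx : 0 < x) : tailTerm a β x = a.im * x ^ (-(β + 1)) := by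
  rw [tailTerm, invPow, if_pos hx, Complex.im_mul_ofReal]

theorem tailTerm_neg {x : ℝ} (hx : 0 < x) :
    tailTerm a β (-x) = negCoeff a β * x ^ (-(β + 1)) := by
  rw [tailTerm, invPow, if_neg (by linarith), ← mul_assoc, Complex.im_mul_ofReal, abs_neg,
    abs_of_pos hx, negCoeff]

/-- Since `e ^ (iπ(β + 1)) = -(-1) ^ n e ^ (iπ(β - n))`, the left side is `|Im (a (1 - e ^ (iπ(β -
n))))|`, and `|e ^ (iθ) - 1| ≤ |θ|`. The factor `|n - β|` cancels the small denominators of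
`primitiveCoeff` and excludes logarithms. -/
theorem abs_im_add_negCoeff_le (a : ℂ) (β : ℝ) (n : ℕ) :
    |a.im + (-1) ^ n * negCoeff a β| ≤ Real.pi * ‖a‖ * |n - β| := by
  have h1 : a.im + (-1) ^ n * negCoeff a β =
      (a * -(Complex.exp (Complex.I * ((Real.pi * (β - n) : ℝ) : ℂ)) - 1)).im := by
    have h2 : Complex.exp (Complex.I * (((β + 1 : ℝ) : ℂ) * Real.pi)) =
        -((-1) ^ n * Complex.exp (Complex.I * ((Real.pi * (β - n) : ℝ) : ℂ))) := by
      rw [← Complex.exp_pi_mul_I, ← Complex.exp_nat_mul, ← Complex.exp_add]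
      have : Complex.I * (((β + 1 : ℝ) : ℂ) * Real.pi) = (n * (Real.pi * Complex.I) +
          Complex.I * ((Real.pi * (β - n) : ℝ) : ℂ)) + Real.pi * Complex.I := by
        push_cast
        ring
      rw [this, Complex.exp_add, Complex.exp_pi_mul_I]
      ring
    have h3 : (-1 : ℝ) ^ n * (-1) ^ n = 1 := by
      rw [← mul_pow]
      simp
    have h4 : (a * -(Complex.exp (Complex.I * ((Real.pi * (β - n) : ℝ) : ℂ)) - 1)) =
        a + (((-1) ^ n : ℝ) : ℂ) * (a * Complex.exp (Complex.I * (((β + 1 : ℝ) : ℂ) * Real.pi))) := by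
      rw [h2]
      have h5 : (((-1) ^ n : ℝ) : ℂ) * (-1) ^ n = 1 := by exact_mod_cast h3
      linear_combination a * Complex.exp (Complex.I * ((Real.pi * (β - n) : ℝ) : ℂ)) * h5
    rw [h4, Complex.add_im, Complex.im_ofReal_mul, negCoeff]
  rw [h1]
  refine (Complex.abs_im_le_norm _).trans ?_
  rw [norm_mul, norm_neg]
  calc _ ≤ ‖a‖ * ‖Real.pi * (β - n)‖ := by
        gcongr
        exact Real.norm_exp_I_mul_ofReal_sub_one_le
    _ = _ := by
        rw [norm_mul, Real.norm_of_nonneg Real.pi_pos.le, Real.norm_eq_abs, abs_sub_comm]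
        ring

theorem im_add_negCoeff_eq_zero (n : ℕ) (hn : (n : ℝ) = β) :
    a.im + (-1) ^ n * negCoeff a β = 0 := by
  have h := abs_im_add_negCoeff_le a β n
  rw [hn, sub_self, abs_zero, mul_zero] at h
  exact abs_nonpos_iff.1 h

theorem abs_primitiveCoeff_le (n : ℕ) :
    |primitiveCoeff a.im (negCoeff a β) β n| ≤ Real.pi * ‖a‖ := by
  rw [primitiveCoeff, abs_div]
  have h1 : 0 ≤ Real.pi * ‖a‖ := by positivity
  exact div_le_of_le_mul₀ (abs_nonneg _) h1 (abs_im_add_negCoeff_le a β n)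

theorem abs_tailTerm_le (x : ℝ) : |tailTerm a β x| ≤ ‖a‖ * |x| ^ (-(β + 1)) := by
  rw [tailTerm]
  refine (Complex.abs_im_le_norm _).trans ?_
  rw [norm_mul, norm_invPow]

theorem continuousAt_tailTerm {x : ℝ} (hx : x ≠ 0) : ContinuousAt (tailTerm a β) x :=
  Complex.continuous_im.continuousAt.comp (continuousAt_const.mul (continuousAt_invPow hx _))

theorem setIntegral_abs_rpow (hβ : 0 < β) (hR : 0 < R) :
    IntegrableOn (fun x : ℝ => |x| ^ (-(β + 1))) {x | R ≤ |x|} ∧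
      ∫ x in {x | R ≤ |x|}, |x| ^ (-(β + 1)) = 2 * R ^ (-β) / β := by
  have h0 : IntegrableOn (fun x : ℝ => x ^ (-(β + 1))) (Set.Ioi R) :=
    integrableOn_Ioi_rpow_of_lt (by linarith) hR
  have h1 : IntegrableOn (fun x : ℝ => |x| ^ (-(β + 1))) (Set.Ioi R) :=
    h0.congr_fun (fun x hx => by rw [abs_of_pos (hR.trans hx)]) measurableSet_Ioi
  have h2 : IntegrableOn (fun x : ℝ => |-x| ^ (-(β + 1))) (Set.Ioi R) := by
    simpa only [abs_neg] using h1
  refine ⟨integrableOn_le_abs h1 h2, ?_⟩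
  rw [setIntegral_le_abs hR h1 h2]
  have h3 : ∫ x in Set.Ioi R, (|x| ^ (-(β + 1)) + |-x| ^ (-(β + 1))) =
      ∫ x in Set.Ioi R, 2 * x ^ (-(β + 1)) := by
    refine setIntegral_congr_fun measurableSet_Ioi fun x hx => ?_
    simp only [abs_neg, abs_of_pos (hR.trans hx)]
    ring
  rw [h3, integral_const_mul, integral_Ioi_rpow_of_lt (by linarith) hR,
    show -(β + 1) + 1 = -β by ring]
  have := hβ.ne'
  field_simp

theorem measurableSet_le_abs (R : ℝ) : MeasurableSet {x : ℝ | R ≤ |x|} :=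
  measurableSet_le measurable_const measurable_abs

theorem aestronglyMeasurable_tailTerm (hR : 0 < R) :
    AEStronglyMeasurable (tailTerm a β) (volume.restrict {x | R ≤ |x|}) := by
  refine ContinuousOn.aestronglyMeasurable (fun x hx => ?_) (measurableSet_le_abs R)
  refine (continuousAt_tailTerm fun h => ?_).continuousWithinAt
  rw [h, Set.mem_ofPred_eq, abs_zero] at hx
  linarith

theorem integrableOn_exp_mul_tailTerm (hβ : 0 < β) (hR : 0 < R) (z : ℝ) :
    IntegrableOn (fun x : ℝ => Complex.exp (z * x * Complex.I) * (tailTerm a β x : ℂ))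
      {x | R ≤ |x|} := by
  refine Integrable.mono' ((setIntegral_abs_rpow hβ hR).1.const_mul ‖a‖)
    (AEStronglyMeasurable.mul (Continuous.aestronglyMeasurable (by fun_prop))
      (Complex.continuous_ofReal.comp_aestronglyMeasurable (aestronglyMeasurable_tailTerm hR)))
    (ae_of_all _ fun x => ?_)
  rw [norm_mul, ← Complex.ofReal_mul, Complex.norm_exp_ofReal_mul_I, one_mul, Complex.norm_real]
  exact abs_tailTerm_le x

theorem integral_norm_exp_mul_tailTerm_le (hβ : 0 < β) (hR : 0 < R) (z : ℝ) :
    ∫ x in {x | R ≤ |x|}, ‖Complex.exp (z * x * Complex.I) * (tailTerm a β x : ℂ)‖ ≤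
      ‖a‖ * (2 * R ^ (-β) / β) := by
  rw [← (setIntegral_abs_rpow hβ hR).2, ← integral_const_mul]
  refine integral_mono (integrableOn_exp_mul_tailTerm hβ hR z).norm
    ((setIntegral_abs_rpow hβ hR).1.const_mul ‖a‖) fun x => ?_
  simp only
  rw [norm_mul, ← Complex.ofReal_mul, Complex.norm_exp_ofReal_mul_I, one_mul, Complex.norm_real]
  exact abs_tailTerm_le x

/-- Fold the negative half-line onto the positive one and substitute `u = z x`; homogeneity produces
the factor `z ^ β`. -/
theorem setIntegral_exp_mul_tailTerm (hβ : 0 < β) (hR : 0 < R) {z : ℝ} (hz : 0 < z) :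
    ∫ x in {x | R ≤ |x|}, Complex.exp (z * x * Complex.I) * (tailTerm a β x : ℂ) =
      ((z ^ β : ℝ) : ℂ) * ∫ u in Set.Ioi (z * R), fourierKernel a.im (negCoeff a β) β u := by
  have hi := integrableOn_exp_mul_tailTerm (a := a) hβ hR z
  rw [setOf_le_abs, integrableOn_union] at hi
  have h1 : IntegrableOn (fun x : ℝ => Complex.exp (z * x * Complex.I) * (tailTerm a β x : ℂ))
      (Set.Ioi R) := hi.2.mono_set Set.Ioi_subset_Ici_self
  have h2 : IntegrableOn (fun x : ℝ => Complex.exp (z * (-x : ℝ) * Complex.I) *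
      (tailTerm a β (-x) : ℂ)) (Set.Ioi R) :=
    (hi.1.mono_set Set.Iio_subset_Iic_self).comp_neg_Ioi
  rw [setIntegral_le_abs hR h1 h2]
  have h3 := integral_comp_mul_left_Ioi (fourierKernel a.im (negCoeff a β) β) R hz
  have h4 : ∫ u in Set.Ioi (z * R), fourierKernel a.im (negCoeff a β) β u =
      z * ∫ x in Set.Ioi R, fourierKernel a.im (negCoeff a β) β (z * x) := by
    rw [h3, Complex.real_smul, ← mul_assoc, ← Complex.ofReal_mul, mul_inv_cancel₀ hz.ne']
    simp
  rw [h4, ← mul_assoc, ← integral_const_mul]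
  refine setIntegral_congr_fun measurableSet_Ioi fun x hx => ?_
  have hx0 : 0 < x := hR.trans hx
  have h5 : ((z ^ β : ℝ) : ℂ) * z * (((z * x) ^ (-(β + 1)) : ℝ) : ℂ) = ((x ^ (-(β + 1)) : ℝ) : ℂ) := by
    have : z ^ β * z * (z * x) ^ (-(β + 1)) = x ^ (-(β + 1)) := by
      rw [Real.mul_rpow hz.le hx0.le, ← mul_assoc]
      nth_rewrite 2 [← Real.rpow_one z]
      rw [← Real.rpow_add hz, ← Real.rpow_add hz]
      simp
    exact_mod_cast this
  simp only [fourierKernel, tailTerm_of_pos hx0, tailTerm_neg hx0]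
  have e1 : (z : ℂ) * x * Complex.I = Complex.I * ((z * x : ℝ) : ℂ) := by push_cast; ring
  have e2 : (z : ℂ) * ((-x : ℝ) : ℂ) * Complex.I = -(Complex.I * ((z * x : ℝ) : ℂ)) := by
    push_cast; ring
  rw [e1, e2, Complex.ofReal_mul (a.im), Complex.ofReal_mul (negCoeff a β), ← h5]
  ring

/-- The coefficients of the analytic part of the Fourier transform of a tail term. -/
noncomputable def analyticCoeff (a : ℂ) (β R : ℝ) (n : ℕ) : ℝ :=
  -(primitiveCoeff a.im (negCoeff a β) β n * R ^ ((n : ℝ) - β))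

theorem abs_analyticCoeff_le (hR : 0 < R) (n : ℕ) :
    |analyticCoeff a β R n| ≤ Real.pi * ‖a‖ * R ^ (-β) * R ^ n := by
  have h3 : R ^ ((n : ℝ) - β) = R ^ (-β) * R ^ n := by
    rw [← Real.rpow_natCast R n, ← Real.rpow_add hR]
    ring_nf
  rw [analyticCoeff, abs_neg, abs_mul, abs_of_pos (Real.rpow_pos_of_pos hR _), h3, ← mul_assoc]
  gcongr
  exact abs_primitiveCoeff_le n

theorem exists_setIntegral_exp_mul_tailTerm (a : ℂ) (hβ : 0 < β) (hR : 0 < R) :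
    ∃ K : ℂ, ∀ z : ℝ, 0 < z →
      ∫ x in {x | R ≤ |x|}, Complex.exp (z * x * Complex.I) * (tailTerm a β x : ℂ) =
        K * ((z ^ β : ℝ) : ℂ) + ∑' n : ℕ, (analyticCoeff a β R n : ℂ) * Complex.I ^ n /
          n.factorial * (z : ℂ) ^ n := by
  obtain ⟨K, hK⟩ := exists_integral_Ioi_fourierKernel (p := a.im) (q := negCoeff a β) hβ
    im_add_negCoeff_eq_zero abs_primitiveCoeff_le
  refine ⟨K, fun z hz => ?_⟩
  rw [setIntegral_exp_mul_tailTerm hβ hR hz, hK _ (mul_pos hz hR), mul_sub, ← tsum_mul_left,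
    sub_eq_add_neg, ← tsum_neg, mul_comm]
  congr 1
  refine tsum_congr fun n => ?_
  have h1 : z ^ β * (z * R) ^ ((n : ℝ) - β) = R ^ ((n : ℝ) - β) * z ^ n := by
    rw [Real.mul_rpow hz.le hR.le, ← mul_assoc, ← Real.rpow_add hz, add_sub_cancel,
      Real.rpow_natCast, mul_comm]
  have h2 : ((z ^ β : ℝ) : ℂ) * (((z * R) ^ ((n : ℝ) - β) : ℝ) : ℂ) =
      ((R ^ ((n : ℝ) - β) : ℝ) : ℂ) * (z : ℂ) ^ n := by exact_mod_cast h1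
  rw [analyticCoeff]
  push_cast
  linear_combination -((primitiveCoeff a.im (negCoeff a β) β n : ℂ) * Complex.I ^ n /
    n.factorial) * h2

end PowerLaw

/-! ### From a power law tail to an expansion. -/

namespace PowerLaw

open Filter Topology

variable {S : AddSubsemigroup ℝ} {c : ℝ} {μ : Measure ℝ}

theorem abs_setIntegral_pow_le [IsProbabilityMeasure μ] (R : ℝ) (hR : 0 ≤ R) (n : ℕ) :
    |∫ x in {x | R ≤ |x|}ᶜ, x ^ n ∂μ| ≤ R ^ n := by
  have h := norm_setIntegral_le_of_norm_le_const (μ := μ) (s := {x : ℝ | R ≤ |x|}ᶜ)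
    (f := fun x => x ^ n) (C := R ^ n) (measure_lt_top _ _) fun x hx => by
      have hx' : ¬R ≤ |x| := hx
      rw [norm_pow]
      exact pow_le_pow_left₀ (norm_nonneg _) (not_le.1 hx').le n
  refine h.trans (mul_le_of_le_one_right (by positivity) measureReal_le_one)

/-- The Fourier transform of the central part of a probability measure is entire. -/
theorem hasSum_setIntegral_exp [IsProbabilityMeasure μ] (R z : ℝ) :
    HasSum (fun n : ℕ => ((∫ x in {x | R ≤ |x|}ᶜ, x ^ n ∂μ : ℝ) : ℂ) * Complex.I ^ n /
        n.factorial * (z : ℂ) ^ n)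
      (∫ x in {x | R ≤ |x|}ᶜ, Complex.exp (z * x * Complex.I) ∂μ) := by
  have hT := (measurableSet_le_abs R).compl
  have h := hasSum_integral_of_dominated_convergence (μ := μ.restrict {x | R ≤ |x|}ᶜ)
    (F := fun (n : ℕ) (x : ℝ) => (Complex.I ^ n / n.factorial * (z : ℂ) ^ n) * ((x ^ n : ℝ) : ℂ))
    (f := fun x : ℝ => Complex.exp (z * x * Complex.I))
    (fun n _ => (|z| * R) ^ n / n.factorial)
    (fun n => Continuous.aestronglyMeasurable (by fun_prop)) (fun n => ?_)
    (ae_of_all _ fun _ => Real.summable_pow_div_factorial _) (integrable_const _)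
    (ae_of_all _ fun x => ?_)
  · refine h.congr_fun fun n => ?_
    rw [integral_const_mul, integral_complex_ofReal]
    ring
  · filter_upwards [ae_restrict_mem hT] with x hx
    have hx' : |x| < R := not_le.1 hx
    rw [norm_mul, norm_mul, norm_div, norm_pow, norm_pow, Complex.norm_I, one_pow,
      Complex.norm_real, Complex.norm_real, Complex.norm_natCast, Real.norm_eq_abs, norm_pow,
      Real.norm_eq_abs, mul_pow]
    calc _ = |z| ^ n * |x| ^ n / n.factorial := by ring
      _ ≤ _ := by gcongr
  · have h1 := NormedSpace.expSeries_div_hasSum_exp (z * x * Complex.I)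
    rw [← Complex.exp_eq_exp_ℂ] at h1
    refine h1.congr_fun fun n => ?_
    rw [mul_pow, mul_pow]
    push_cast
    ring

theorem norm_mul_rpow_neg_le {a : ℂ} {r R β : ℝ} (hr : 0 ≤ r) (hR : 0 < R) (ha : ‖a‖ ≤ r ^ β) :
    ‖a‖ * R ^ (-β) ≤ (r / R) ^ β := by
  rw [Real.div_rpow hr hR.le, Real.rpow_neg hR.le, div_eq_mul_inv]
  gcongr

/-- The `L¹` norm of the term of index `β` is at most `2 (r / R) ^ β / β`, which is summable because
`β` is bounded below by some `b > 0`. Nonnegativity of the density makes `ENNReal.ofReal` lossless.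
-/
theorem hasSum_setIntegral_exp_mul_tailTerm (hS : IsExponentSet S c) {a : ℝ → ℂ} {r R : ℝ}
    (hr : 0 < r) (hrR : c * r < R) (ha : ∀ β ∈ S, 0 < β → ‖a β‖ ≤ r ^ β)
    (hnn : ∀ x : ℝ, R ≤ |x| → 0 ≤ tailDensity S a x)
    (hμ : μ.restrict {x | R ≤ |x|} =
      (volume.restrict {x | R ≤ |x|}).withDensity (fun x => ENNReal.ofReal (tailDensity S a x)))
    (z : ℝ) :
    HasSum (fun β : {β : ℝ // β ∈ S ∧ 0 < β} =>
        ∫ x in {x | R ≤ |x|}, Complex.exp (z * x * Complex.I) * (tailTerm (a β) β x : ℂ))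
      (∫ x in {x | R ≤ |x|}, Complex.exp (z * x * Complex.I) ∂μ) := by
  have hR : 0 < R := (mul_pos hS.pos hr).trans hrR
  have := hS.countable
  have : Countable {β : ℝ // β ∈ S ∧ 0 < β} := (injective_pos_mem S).countable
  obtain ⟨b, hb, -, hmin⟩ := hS.exists_pos_le
  have hsum := (hS.summable_div_rpow_pos_mem hr hrR).mul_right (R * (2 / b))
  have h := hasSum_integral_of_summable_integral_norm (μ := volume.restrict {x | R ≤ |x|})
    (F := fun (β : {β : ℝ // β ∈ S ∧ 0 < β}) (x : ℝ) =>
      Complex.exp (z * x * Complex.I) * (tailTerm (a β) β x : ℂ))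
    (fun β => integrableOn_exp_mul_tailTerm β.2.2 hR z)
    (Summable.of_nonneg_of_le (fun β => integral_nonneg fun _ => norm_nonneg _) (fun β => ?_) hsum)
  · suffices e : ∫ x in {x | R ≤ |x|}, Complex.exp (z * x * Complex.I) ∂μ =
        ∫ x in {x | R ≤ |x|}, ∑' β : {β : ℝ // β ∈ S ∧ 0 < β},
          Complex.exp (z * x * Complex.I) * (tailTerm (a β) β x : ℂ) by
      rw [e]
      exact h
    rw [hμ, integral_withDensity_eq_integral_toReal_smul₀
      ((continuousOn_tailDensity hS hr hrR ha).aestronglyMeasurable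
        (measurableSet_le_abs R)).aemeasurable.ennreal_ofReal
      (ae_of_all _ fun _ => ENNReal.ofReal_lt_top)]
    refine setIntegral_congr_fun (measurableSet_le_abs R) fun x hx => ?_
    rw [ENNReal.toReal_ofReal (hnn x hx), tsum_mul_left, Complex.real_smul, mul_comm,
      ← Complex.ofReal_tsum]
    rfl
  · refine (integral_norm_exp_mul_tailTerm_le β.2.2 hR z).trans ?_
    have h1 := norm_mul_rpow_neg_le hr.le hR (ha β β.2.1 β.2.2)
    have h2 := hmin β β.2.1 β.2.2
    have h3 : 0 < (β : ℝ) := β.2.2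
    calc ‖a β‖ * (2 * R ^ (-(β : ℝ)) / β) = ‖a β‖ * R ^ (-(β : ℝ)) * (2 / β) := by ring
      _ ≤ (r / R) ^ (β : ℝ) * (2 / b) := by gcongr
      _ = _ := by field_simp

/-- The bound separates `β` from `n`, so the double series converges absolutely and may be regrouped
by powers of `z`. -/
theorem norm_analyticTerm_le {a : ℂ} {r R β : ℝ} (hr : 0 ≤ r) (hR : 0 < R) (ha : ‖a‖ ≤ r ^ β)
    {z : ℝ} (hz : 0 < z) (n : ℕ) :
    ‖(analyticCoeff a β R n : ℂ) * Complex.I ^ n / n.factorial * (z : ℂ) ^ n‖ ≤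
      Real.pi * (r / R) ^ β * ((R * z) ^ n / n.factorial) := by
  rw [norm_mul, norm_div, norm_mul, norm_pow, norm_pow, Complex.norm_I, one_pow, mul_one,
    Complex.norm_real, Complex.norm_real, Complex.norm_natCast, Real.norm_eq_abs,
    Real.norm_of_nonneg hz.le]
  have h1 := norm_mul_rpow_neg_le hr hR ha
  calc _ ≤ Real.pi * ‖a‖ * R ^ (-β) * R ^ n / n.factorial * z ^ n := by
        gcongr
        exact abs_analyticCoeff_le hR n
    _ = Real.pi * (‖a‖ * R ^ (-β)) * ((R * z) ^ n / n.factorial) := by rw [mul_pow]; ring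
    _ ≤ _ := by gcongr

theorem IsExponentSet.summable_div_rpow_pos (hS : IsExponentSet S c) {r R : ℝ} (hr : 0 < r)
    (hrR : c * r < R) : Summable fun β : {β : ℝ // β ∈ S ∧ 0 < β} => (r / R) ^ (β : ℝ) := by
  have hR : 0 < R := (mul_pos hS.pos hr).trans hrR
  refine ((hS.summable_div_rpow_pos_mem hr hrR).mul_right R).congr fun β => ?_
  rw [mul_assoc, inv_mul_cancel₀ hR.ne', mul_one]

theorem summable_analyticTerm (hS : IsExponentSet S c) {a : ℝ → ℂ} {r R : ℝ}
    (hr : 0 < r) (hrR : c * r < R) (ha : ∀ β ∈ S, 0 < β → ‖a β‖ ≤ r ^ β) {z : ℝ} (hz : 0 < z) :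
    Summable fun q : {β : ℝ // β ∈ S ∧ 0 < β} × ℕ =>
      (analyticCoeff (a q.1) q.1 R q.2 : ℂ) * Complex.I ^ q.2 / q.2.factorial * (z : ℂ) ^ q.2 := by
  have hR : 0 < R := (mul_pos hS.pos hr).trans hrR
  refine Summable.of_norm_bounded ((((hS.summable_div_rpow_pos hr hrR).mul_left Real.pi)).mul_of_nonneg
    (Real.summable_pow_div_factorial (R * z)) (fun β => ?_) fun n => ?_) fun q =>
    norm_analyticTerm_le hr.le hR (ha q.1 q.1.2.1 q.1.2.2) hz q.2
  · simp only [Pi.zero_apply]; positivity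
  · simp only [Pi.zero_apply]; positivity

/-- A non-integral and an integral part of an expansion combine to a complex moment family. -/
theorem exists_isComplexMomentFamily_of_hasSum [IsProbabilityMeasure μ] (hS : IsExponentSet S c)
    {K : {β : ℝ // β ∈ S ∧ 0 < β} → ℂ} {N : ℕ → ℂ} {M k : ℝ} (hk : 0 < k) (hM : 0 ≤ M)
    (hK : ∀ β, ‖K β‖ * Real.Gamma (β + 1) ≤ M * k ^ (β : ℝ)) (hN : ∀ n, ‖N n‖ ≤ M * k ^ n)
    {x y : ℝ → ℂ} (hx : ∀ z : ℝ, 0 < z → HasSum (fun β => K β * ((z ^ (β : ℝ) : ℝ) : ℂ)) (x z))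
    (hy : ∀ z : ℝ, 0 < z →
      HasSum (fun n : ℕ => N n * Complex.I ^ n / n.factorial * (z : ℂ) ^ n) (y z))
    (hxy : ∀ z : ℝ, 0 < z → charFun μ z = x z + y z) :
    ∃ m : S → ℂ, IsComplexMomentFamily S μ m := by
  set ι : {β : ℝ // β ∈ S ∧ 0 < β} → S := fun β => ⟨β, β.2.1⟩ with hι
  have hιi : Function.Injective ι := injective_pos_mem S
  set ν : ℕ → S := fun n => ⟨n, hS.natCast_mem n⟩ with hν
  have hνi : Function.Injective ν := fun n n' h => by
    have := congrArg Subtype.val h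
    simpa [hν] using this
  have hG : ∀ γ : S, 0 < Real.Gamma ((γ : ℝ) + 1) := fun γ =>
    Real.Gamma_pos_of_pos (by linarith [hS.nonneg _ γ.2])
  have hGC : ∀ γ : S, (Real.Gamma ((γ : ℝ) + 1) : ℂ) ≠ 0 := fun γ => by
    exact_mod_cast (hG γ).ne'
  -- A positive integer is an index of both families, so both are extended by zero to `S` and added.
  -- `K` is a raw coefficient of `z ^ β` and needs the factor `Γ(γ + 1) / i ^ γ`, whereas `N` is
  -- already normalised as a moment.
  refine ⟨fun γ => Function.extend ι K 0 γ * Real.Gamma (γ + 1) / Complex.I ^ ((γ : ℝ) : ℂ) +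
    Function.extend ν N 0 γ, IsComplexMomentFamily.of_hasSum hS (M := 2 * M) hk (fun γ => ?_)
    fun z hz => ?_⟩
  · have hpos : 0 ≤ M * k ^ (γ : ℝ) := by positivity
    have h1 : ‖Function.extend ι K 0 γ * Real.Gamma (γ + 1) / Complex.I ^ ((γ : ℝ) : ℂ)‖ ≤
        M * k ^ (γ : ℝ) := by
      rw [norm_div, norm_I_cpow, div_one, norm_mul, Complex.norm_real,
        Real.norm_of_nonneg (hG γ).le]
      by_cases hγ : ∃ β, ι β = γ
      · obtain ⟨β, rfl⟩ := hγ
        rw [hιi.extend_apply]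
        exact hK β
      · rw [Function.extend_apply' _ _ _ hγ]
        simpa using hpos
    have h2 : ‖Function.extend ν N 0 γ‖ ≤ M * k ^ (γ : ℝ) := by
      by_cases hγ : ∃ n, ν n = γ
      · obtain ⟨n, rfl⟩ := hγ
        rw [hνi.extend_apply, hν, Real.rpow_natCast]
        exact hN n
      · rw [Function.extend_apply' _ _ _ hγ]
        simpa using hpos
    exact (norm_add_le _ _).trans (by linarith)
  · rw [hxy z hz]
    have h1 : HasSum (fun γ : S => Function.extend ι K 0 γ * ((z ^ (γ : ℝ) : ℝ) : ℂ)) (x z) := by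
      refine (hιi.hasSum_iff fun γ hγ => ?_).1 ?_
      · rw [Function.extend_apply' _ _ _ fun h => hγ h]
        simp
      · refine (hx z hz).congr_fun fun β => ?_
        simp only [Function.comp_apply, hιi.extend_apply]
        rfl
    have h2 : HasSum (fun γ : S => Function.extend ν N 0 γ / (Real.Gamma (γ + 1) : ℂ) *
        Complex.I ^ ((γ : ℝ) : ℂ) * ((z ^ (γ : ℝ) : ℝ) : ℂ)) (y z) := by
      refine (hνi.hasSum_iff fun γ hγ => ?_).1 ?_
      · rw [Function.extend_apply' _ _ _ fun h => hγ h]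
        simp
      · refine (hy z hz).congr_fun fun n => ?_
        simp only [Function.comp_apply, hνi.extend_apply]
        simp only [hν, Real.Gamma_nat_eq_factorial, Complex.ofReal_natCast, Complex.cpow_natCast,
          Real.rpow_natCast, Complex.ofReal_pow]
        ring
    refine (h1.add h2).congr_fun fun γ => ?_
    have := hGC γ
    have := I_cpow_ne_zero ((γ : ℝ) : ℂ)
    field_simp

/-- The Fourier transform of a member of the power law class has an expansion with exponents in
`S`. -/
theorem exists_isComplexMomentFamily (hS : IsExponentSet S c) (hμ : μ ∈ powerLawClass S c) :
    ∃ m : S → ℂ, IsComplexMomentFamily S μ m := by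
  obtain ⟨hprob, a, r, R, hr, hR, ha, hrR', hnn, hdens⟩ := hμ
  have hrR : c * r < R := (lt_inv_mul_iff₀ hS.pos).1 hrR'
  obtain ⟨b, hb, -, hmin⟩ := hS.exists_pos_le
  have hrR1 : r / R ≤ 1 := by
    rw [div_le_one hR]
    nlinarith [hS.one_le]
  choose K hK using fun β : {β : ℝ // β ∈ S ∧ 0 < β} =>
    exists_setIntegral_exp_mul_tailTerm (a β) β.2.2 hR
  set W := ∑' β : {β : ℝ // β ∈ S ∧ 0 < β}, (r / R) ^ (β : ℝ) with hW
  have hws := hS.summable_div_rpow_pos hr hrR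
  have hW0 : 0 ≤ W := tsum_nonneg fun β => by positivity
  set d : {β : ℝ // β ∈ S ∧ 0 < β} → ℕ → ℝ := fun β n => analyticCoeff (a β) β R n with hd
  have hdle : ∀ n β, ‖d β n‖ ≤ Real.pi * R ^ n * (r / R) ^ (β : ℝ) := fun n β => by
    refine (abs_analyticCoeff_le hR n).trans ?_
    have h1 := norm_mul_rpow_neg_le hr.le hR (ha β β.2.1 β.2.2)
    calc _ = Real.pi * R ^ n * (‖a β‖ * R ^ (-(β : ℝ))) := by ring
      _ ≤ _ := by gcongr
  have hAn : ∀ z : ℝ, 0 < z → ∀ β : {β : ℝ // β ∈ S ∧ 0 < β},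
      ‖∑' n : ℕ, (d β n : ℂ) * Complex.I ^ n / n.factorial * (z : ℂ) ^ n‖ ≤
        Real.pi * (r / R) ^ (β : ℝ) * Real.exp (R * z) := fun z hz β => by
    have h1 := (NormedSpace.expSeries_div_hasSum_exp (R * z)).mul_left
      (Real.pi * (r / R) ^ (β : ℝ))
    rw [← Real.exp_eq_exp_ℝ] at h1
    exact tsum_of_norm_bounded h1 fun n =>
      norm_analyticTerm_le hr.le hR (ha β β.2.1 β.2.2) hz n
  set total : ℝ → ℂ := fun z => ∑' q : {β : ℝ // β ∈ S ∧ 0 < β} × ℕ,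
    (d q.1 q.2 : ℂ) * Complex.I ^ q.2 / q.2.factorial * (z : ℂ) ^ q.2 with htotal
  have hsm := fun (z : ℝ) (hz : 0 < z) => summable_analyticTerm hS hr hrR ha hz
  have hT := measurableSet_le_abs R
  -- `total` collects the entire parts of all tail terms. Subtracting it from the tail leaves `∑ K z
  -- ^ β`; adding it to the central part leaves a power series in `z`. In `M`, the summand with `2 /
  -- b` serves `K` and the one with `W` serves `N`.
  refine exists_isComplexMomentFamily_of_hasSum hS (K := K)
    (N := fun n => ((∫ x in {x | R ≤ |x|}ᶜ, x ^ n ∂μ : ℝ) : ℂ) + ((∑' β, d β n : ℝ) : ℂ))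
    (M := (2 / b + Real.pi) * (R + 1) + (1 + Real.pi * W)) (k := R + 1) (by positivity)
    (by positivity) (fun β => ?_) (fun n => ?_)
    (x := fun z => (∫ x in {x | R ≤ |x|}, Complex.exp (z * x * Complex.I) ∂μ) - total z)
    (y := fun z => (∫ x in {x | R ≤ |x|}ᶜ, Complex.exp (z * x * Complex.I) ∂μ) + total z)
    (fun z hz => ?_) (fun z hz => ?_) fun z hz => ?_
  -- `K z ^ β` is a bounded tail integral minus an entire function of size `O(e ^ (Rz))`, uniformly
  -- in `β`, so the Gamma estimate applies.
  · have h1 : ‖K β‖ * Real.Gamma (β + 1) ≤ (2 / b + Real.pi) * (R + 1) ^ ((β : ℝ) + 1) := by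
      refine mul_Gamma_le_of_forall_mul_rpow_le hR.le β.2.2.le fun z hz => ?_
      have hw1 : (r / R) ^ (β : ℝ) ≤ 1 := Real.rpow_le_one (by positivity) hrR1 β.2.2.le
      have h2 : ‖∫ x in {x | R ≤ |x|}, Complex.exp (z * x * Complex.I) *
          (tailTerm (a β) β x : ℂ)‖ ≤ 2 / b := by
        refine (norm_integral_le_integral_norm _).trans
          ((integral_norm_exp_mul_tailTerm_le β.2.2 hR z).trans ?_)
        have h3 := norm_mul_rpow_neg_le hr.le hR (ha β β.2.1 β.2.2)
        have h4 := hmin β β.2.1 β.2.2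
        have h5 : 0 < (β : ℝ) := β.2.2
        calc ‖a β‖ * (2 * R ^ (-(β : ℝ)) / β) = ‖a β‖ * R ^ (-(β : ℝ)) * (2 / β) := by ring
          _ ≤ 1 * (2 / b) := by
            gcongr
            exact h3.trans hw1
          _ = _ := one_mul _
      have h5 : K β * ((z ^ (β : ℝ) : ℝ) : ℂ) = (∫ x in {x | R ≤ |x|},
          Complex.exp (z * x * Complex.I) * (tailTerm (a β) β x : ℂ)) -
          ∑' n : ℕ, (d β n : ℂ) * Complex.I ^ n / n.factorial * (z : ℂ) ^ n := by
        rw [hK β z hz]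
        ring
      have h6 : ‖K β‖ * z ^ (β : ℝ) = ‖K β * ((z ^ (β : ℝ) : ℝ) : ℂ)‖ := by
        rw [norm_mul, Complex.norm_real, Real.norm_of_nonneg (by positivity)]
      have h7 : 1 ≤ Real.exp (R * z) := Real.one_le_exp (by positivity)
      rw [h6, h5]
      calc _ ≤ 2 / b + Real.pi * (r / R) ^ (β : ℝ) * Real.exp (R * z) :=
            (norm_sub_le _ _).trans (add_le_add h2 (hAn z hz β))
        _ ≤ 2 / b * Real.exp (R * z) + Real.pi * 1 * Real.exp (R * z) := by
            gcongr
            exact le_mul_of_one_le_right (by positivity) h7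
        _ = _ := by ring
    refine h1.trans ?_
    rw [Real.rpow_add (by positivity), Real.rpow_one]
    have h8 : 0 ≤ (1 + Real.pi * W) * (R + 1) ^ (β : ℝ) := by positivity
    linarith
  · rw [← Complex.ofReal_add, Complex.norm_real]
    have h1 := abs_setIntegral_pow_le (μ := μ) R hR.le n
    have h2 : ‖∑' β, d β n‖ ≤ Real.pi * R ^ n * W :=
      tsum_of_norm_bounded (hws.hasSum.mul_left _) (hdle n)
    calc _ ≤ R ^ n + Real.pi * R ^ n * W := (norm_add_le _ _).trans (add_le_add h1 h2)
      _ = (1 + Real.pi * W) * R ^ n := by ring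
      _ ≤ ((2 / b + Real.pi) * (R + 1) + (1 + Real.pi * W)) * (R + 1) ^ n := by
        have h3 : 0 ≤ (2 / b + Real.pi) * (R + 1) := by positivity
        exact mul_le_mul (by linarith) (pow_le_pow_left₀ hR.le (by linarith) n) (by positivity)
          (by positivity)
  · have h1 := hasSum_setIntegral_exp_mul_tailTerm hS hr hrR ha hnn hdens z
    have h2 := (hsm z hz).hasSum.prod_fiberwise fun β => ((hsm z hz).prod_factor β).hasSum
    refine (h1.sub h2).congr_fun fun β => ?_
    rw [hK β z hz]
    ring
  · have h1 := hasSum_setIntegral_exp (μ := μ) R z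
    have hsw := (hsm z hz).prod_symm
    have h2 := hsw.hasSum.prod_fiberwise fun n => (hsw.prod_factor n).hasSum
    have h3 : ∑' q : ℕ × {β : ℝ // β ∈ S ∧ 0 < β},
        (d q.2 q.1 : ℂ) * Complex.I ^ q.1 / q.1.factorial * (z : ℂ) ^ q.1 = total z :=
      (Equiv.prodComm ℕ {β : ℝ // β ∈ S ∧ 0 < β}).tsum_eq (fun q : _ × ℕ =>
        (d q.1 q.2 : ℂ) * Complex.I ^ q.2 / q.2.factorial * (z : ℂ) ^ q.2)
    rw [← h3]
    refine (h1.add h2).congr_fun fun n => ?_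
    simp only [Prod.swap, Complex.ofReal_tsum, div_eq_mul_inv, tsum_mul_right, hd]
    ring
  · rw [charFun_apply_real, sub_add_add_cancel]
    refine (integral_add_compl hT ?_).symm
    refine (integrable_const (1 : ℝ)).mono' (Continuous.aestronglyMeasurable (by fun_prop))
      (ae_of_all _ fun x => ?_)
    rw [← Complex.ofReal_mul, Complex.norm_exp_ofReal_mul_I]

/-- Uniqueness makes the choice in `complexMoment` immaterial. -/
theorem complexMoment_eq (hS : IsExponentSet S c) {m : S → ℂ} (h : IsComplexMomentFamily S μ m) :
    complexMoment S μ = m := by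
  have hex : ∃ m : S → ℂ, IsComplexMomentFamily S μ m := ⟨m, h⟩
  rw [complexMoment, dif_pos hex]
  exact hex.choose_spec.eq hS h

end PowerLaw

/-! ### Closure under convolution and the moment formula. -/

theorem proposition2p10 (S : AddSubsemigroup ℝ) (c : ℝ) (hS : PowerLaw.IsExponentSet S c) :
    (∀ μ ∈ PowerLaw.powerLawClass S c, ∀ ν ∈ PowerLaw.powerLawClass S c,
      MeasureTheory.Measure.conv μ ν ∈ PowerLaw.powerLawClass S c) ∧
    (∀ μ ∈ PowerLaw.powerLawClass S c, ∃! m : S → ℂ, PowerLaw.IsComplexMomentFamily S μ m) ∧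
    (∀ μ ∈ PowerLaw.powerLawClass S c, ∀ ν ∈ PowerLaw.powerLawClass S c, ∀ β : S,
      PowerLaw.complexMoment S (MeasureTheory.Measure.conv μ ν) β =
        ∑ p ∈ hS.decompositions β,
          ((Real.Gamma (β + 1) / (Real.Gamma (p.1 + 1) * Real.Gamma (p.2 + 1)) : ℝ) : ℂ) *
            PowerLaw.complexMoment S μ p.1 * PowerLaw.complexMoment S ν p.2) := by
  refine ⟨fun μ hμ ν hν => ?_, fun μ hμ => ?_, fun μ hμ ν hν β => ?_⟩
  · obtain ⟨m, hm⟩ := PowerLaw.exists_isComplexMomentFamily hS hμ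
    obtain ⟨m', hm'⟩ := PowerLaw.exists_isComplexMomentFamily hS hν
    have := hμ.1
    have := hν.1
    exact (hm.conv hS hm').mem_powerLawClass hS
  · obtain ⟨m, hm⟩ := PowerLaw.exists_isComplexMomentFamily hS hμ
    exact ⟨m, hm, fun m' hm' => hm'.eq hS hm⟩
  · obtain ⟨m, hm⟩ := PowerLaw.exists_isComplexMomentFamily hS hμ
    obtain ⟨m', hm'⟩ := PowerLaw.exists_isComplexMomentFamily hS hν
    have := hμ.1
    have := hν.1
    rw [PowerLaw.complexMoment_eq hS hm, PowerLaw.complexMoment_eq hS hm',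
      PowerLaw.complexMoment_eq hS (hm.conv hS hm')]
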